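/- Let $\Sigma$ be a finite alphabet. **Iposets.** A (labelled, interval) poset with event order and interfaces, for short an *iposet*, is a tuple $P=(P,<,\dashrightarrow,S_P,T_P,\lambda)$ where $P$ is a finite set, $<$ (precedence) and $\dashrightarrow$ (event order) are strict partial orders on $P$ such that any two distinct elements are related by $<$ or by $\dashrightarrow$ (in some direction), $\lambda:P\to\Sigma$ is a labelling, $S_P\subseteq P$ consists of $<$-minimal elements (source interface), $T_P\subseteq P$ consists of $<$-maximal elements (target interface), and $<$ is an interval order: there are $b,e:P\to\mathbb R$ with $b(x)\le e(x)$ for all $x$ and $x<y\iff e(x)<b(y)$ for all $x,y$. Two elements are concurrent if they are not related by $<$. A *subsumption* $P\sqsubseteq Q$ is a bijection $f:P\to Q$ with $f(S_P)=S_Q$, $f(T_P)=T_Q$, $\lambda_Q\circ f=\lambda_P$, such that $f(x)<_Qf(y)$ implies $x<_Py$, and $x\dashrightarrow_Py$ implies $f(x)\dashrightarrow_Qf(y)$ whenever $x,y$ are concurrent in $P$. An isomorphism is such a bijection with, moreover, $x<_Py\iff f(x)<_Qf(y)$, and $x\dashrightarrow_Py\iff f(x)\dashrightarrow_Qf(y)$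 for concurrent $x,y$. *Ipomsets* are isomorphism classes of iposets. A *language* is a set $L$ of ipomsets such that $P\sqsubseteq Q$ and $Q\in L$ imply $P\in L$. **Gluing and quotients.** The gluing $P*Q$ is defined if there is an isomorphism $f:T_P\cong S_Q$ of labelled sets totally ordered by event order; its carrier is $(P\sqcup Q)/(x\sim f(x))$, its interfaces are $S_{P*Q}=S_P$ and $T_{P*Q}=T_Q$, its event order is the transitive closure of $\dashrightarrow_P\cup\dashrightarrow_Q$, and $x<_{P*Q}y$ iff $x<_Py$, or $x<_Qy$, or $x\in P\setminus T_P$ and $y\in Q\setminus S_Q$. For an ipomset $P$, the *prefix quotient* $P\backslash L$ is the set of ipomsets $Q$ such that $P*Q$ is defined and in $L$, and the *suffix quotient* $L/P$ is the set of ipomsets $Q$ such that $Q*P$ is defined and in $L$. **Higher-dimensional automata.** An HDA $X$ consists of sets $X[U]$ of cells for every finite word $U$ over $\Sigma$ (regarded as a list of active labelled events), of lower and upper face maps $\delta^0_A,\delta^1_A:X[U]\to X[U\setminus A]$ for every set $A$ of positions of $U$, with $\delta^\nu_\emptyset=\mathrm{id}$, $\delta^\nu_A\delta^\nu_B=\delta^\nu_{A\cup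 B}$ and $\delta^\nu_A\delta^\mu_B=\delta^\mu_B\delta^\nu_A$ for disjoint $A,B$ and $\nu,\mu\in\{0,1\}$, and of sets of start cells and of accept cells. A path is a finite sequence of cells in which consecutive cells are joined by an upstep $\delta^0_A(x)\nearrow^A x$ or a downstep $x\searrow_A\delta^1_A(x)$, $x\in X[U]$. Write ${}_SU_T$ for the iposet whose events are the positions of $U$, with empty precedence, event order the order of positions, and interfaces $S$, $T$. The ipomset of the upstep is ${}_{U\setminus A}U_U$, that of the downstep is ${}_UU_{U\setminus A}$, that of a path without steps at $x\in X[U]$ is ${}_UU_U$, and that of a path with steps is the gluing of the ipomsets of its steps. The language of $X$ is the set of ipomsets of paths from a start cell to an accept cell. A language is *regular* if it is the language of an HDA with finitely many cells. **Theorem.** For every language $L$ of ipomsets over $\Sigma$ (closed under subsumption as above), the following are equivalent: (a) $L$ is regular; (b) the set of prefix quotients $\{P\backslash L\mid P\text{ an ipomset}\}$ is finite; (c) the set of suffix quotients $\{L/P\mid P\text{ an ipomset}\}$ is finite. -/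

import Mathlib

universe u

/-! ### Iposets -/

/-- A labelled interval poset with event order and interfaces (iposet) over the alphabet `A`, with
carrier `α`.  `prec` is the precedence order, `evord` the event order. -/
structure Iposet (A : Type*) (α : Type*) where
  prec : α → α → Prop
  evord : α → α → Prop
  source : Set α
  target : Set α
  label : α → A
  prec_irrefl : ∀ x, ¬ prec x x
  prec_trans : ∀ x y z, prec x y → prec y z → prec x z
  evord_irrefl : ∀ x, ¬ evord x x
  evord_trans : ∀ x y z, evord x y → evord y z → evord x z
  related : ∀ x y, x ≠ y → prec x y ∨ prec y x ∨ evord x y ∨ evord y x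
  interval : ∃ b e : α → ℝ, (∀ x, b x ≤ e x) ∧ ∀ x y, prec x y ↔ e x < b y
  source_minimal : ∀ x ∈ source, ∀ y, ¬ prec y x
  target_maximal : ∀ x ∈ target, ∀ y, ¬ prec x y

namespace Iposet

variable {A α β γ : Type*}

/-- Two elements are concurrent if they are not related by precedence. -/
def Concurrent (P : Iposet A α) (x y : α) : Prop := ¬ P.prec x y ∧ ¬ P.prec y x

/-- `P` is subsumed by `Q`. -/
def Subsumed (P : Iposet A α) (Q : Iposet A β) : Prop :=
  ∃ f : α ≃ β, f '' P.source = Q.source ∧ f '' P.target = Q.target ∧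
    (∀ x, Q.label (f x) = P.label x) ∧
    (∀ x y, Q.prec (f x) (f y) → P.prec x y) ∧
    (∀ x y, P.Concurrent x y → P.evord x y → Q.evord (f x) (f y))

/-- `P` and `Q` are isomorphic: only the event order between concurrent events matters. -/
def Isomorphic (P : Iposet A α) (Q : Iposet A β) : Prop :=
  ∃ f : α ≃ β, f '' P.source = Q.source ∧ f '' P.target = Q.target ∧
    (∀ x, Q.label (f x) = P.label x) ∧
    (∀ x y, P.prec x y ↔ Q.prec (f x) (f y)) ∧
    (∀ x y, P.Concurrent x y → (P.evord x y ↔ Q.evord (f x) (f y)))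

theorem Isomorphic.refl (P : Iposet A α) : P.Isomorphic P :=
  ⟨Equiv.refl α, by simp, by simp, fun _ => rfl, fun _ _ => Iff.rfl, fun _ _ _ => Iff.rfl⟩

theorem Isomorphic.symm {P : Iposet A α} {Q : Iposet A β} (h : P.Isomorphic Q) :
    Q.Isomorphic P := by
  obtain ⟨f, hS, hT, hl, hp, he⟩ := h
  refine ⟨f.symm, by simp [← hS, Set.image_image], by simp [← hT, Set.image_image],
    fun x => by simp [← hl], fun x y => by simp [hp], fun x y h => ?_⟩
  have := he (f.symm x) (f.symm y) (by simpa [Concurrent, hp] using h)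
  simpa using this.symm

theorem Isomorphic.trans {P : Iposet A α} {Q : Iposet A β} {R : Iposet A γ}
    (h : P.Isomorphic Q) (h' : Q.Isomorphic R) : P.Isomorphic R := by
  obtain ⟨f, hS, hT, hl, hp, he⟩ := h
  obtain ⟨g, hS', hT', hl', hp', he'⟩ := h'
  refine ⟨f.trans g, by simp [← hS', ← hS, Set.image_image],
    by simp [← hT', ← hT, Set.image_image], fun x => by simp [hl, hl'],
    fun x y => by simp [hp, hp'], fun x y h => ?_⟩
  simpa using (he x y h).trans (he' (f x) (f y) (by simpa [Concurrent, hp] using h))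

/-- `R` is the gluing `P * Q`, with `i` and `j` the canonical maps of `P` and `Q` into `R`.
The carrier of `R` is the disjoint union of the carriers of `P` and `Q` in which the target
interface of `P` is identified with the source interface of `Q`, along a bijection (given by
`i x = j y`) which is an isomorphism for the event orders and the labels. -/
structure IsGluingVia (P : Iposet A α) (Q : Iposet A β) (R : Iposet A γ)
    (i : α → γ) (j : β → γ) : Prop where
  left_injective : Function.Injective i
  right_injective : Function.Injective j
  cover : Set.range i ∪ Set.range j = Set.univ
  overlap : ∀ x y, i x = j y → x ∈ P.target ∧ y ∈ Q.source
  left_match : ∀ x ∈ P.target, ∃ y ∈ Q.source, i x = j y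
  right_match : ∀ y ∈ Q.source, ∃ x ∈ P.target, i x = j y
  evord_match : ∀ x y x' y', i x = j y → i x' = j y' → (P.evord x x' ↔ Q.evord y y')
  label_left : ∀ x, R.label (i x) = P.label x
  label_right : ∀ y, R.label (j y) = Q.label y
  source_eq : R.source = i '' P.source
  target_eq : R.target = j '' Q.target
  evord_iff : ∀ u v, R.evord u v ↔
    Relation.TransGen (fun u v => Relation.Map P.evord i i u v ∨ Relation.Map Q.evord j j u v) u v
  prec_iff : ∀ u v, R.prec u v ↔
    Relation.Map P.prec i i u v ∨ Relation.Map Q.prec j j u v ∨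
      ∃ x y, x ∉ P.target ∧ y ∉ Q.source ∧ i x = u ∧ j y = v

/-- `R` is (a copy of) the gluing `P * Q`; in particular `P * Q` is defined. -/
def IsGluing (P : Iposet A α) (Q : Iposet A β) (R : Iposet A γ) : Prop :=
  ∃ (i : α → γ) (j : β → γ), IsGluingVia P Q R i j

/-- The discrete iposet whose events are the positions of the list `U`, with event order the order
of positions, and with the given interfaces. -/
def discrete (U : List A) (S T : Set (Fin U.length)) : Iposet A (Fin U.length) where
  prec _ _ := False
  evord x y := x < y
  source := S
  target := T
  label := U.get
  prec_irrefl _ := id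
  prec_trans _ _ _ h _ := h
  evord_irrefl x := lt_irrefl x
  evord_trans _ _ _ := lt_trans
  related x y h := Or.inr (Or.inr (lt_or_gt_of_ne h))
  interval := ⟨fun _ => 0, fun _ => 0, fun _ => le_rfl, fun _ _ => by simp⟩
  source_minimal _ _ _ := id
  target_maximal _ _ _ := id

end Iposet

/-! ### Ipomsets and languages -/

/-- Finite iposets; up to isomorphism the carrier is `{0, …, n - 1}`. -/
abbrev FinIposet (A : Type*) := (n : ℕ) × Iposet A (Fin n)

instance FinIposet.setoid (A : Type*) : Setoid (FinIposet A) where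
  r P Q := P.2.Isomorphic Q.2
  iseqv := ⟨fun P => .refl P.2, .symm, .trans⟩

/-- Ipomsets: isomorphism classes of finite iposets. -/
def Ipomset (A : Type*) := Quotient (FinIposet.setoid A)

namespace Ipomset

variable {A : Type*}

/-- The isomorphism class of an iposet. -/
def mk {n : ℕ} (P : Iposet A (Fin n)) : Ipomset A := Quotient.mk (FinIposet.setoid A) ⟨n, P⟩

/-- `p` is subsumed by `q`. -/
def Subsumed (p q : Ipomset A) : Prop :=
  ∃ (m n : ℕ) (P : Iposet A (Fin m)) (Q : Iposet A (Fin n)),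
    p = mk P ∧ q = mk Q ∧ P.Subsumed Q

/-- The gluing `p * q` is defined and equal to `r`. -/
def Glues (p q r : Ipomset A) : Prop :=
  ∃ (k m n : ℕ) (P : Iposet A (Fin k)) (Q : Iposet A (Fin m)) (R : Iposet A (Fin n)),
    p = mk P ∧ q = mk Q ∧ r = mk R ∧ P.IsGluing Q R

/-- A language is a set of ipomsets that is closed under refinement (inverse subsumption). -/
def IsLanguage (L : Set (Ipomset A)) : Prop :=
  ∀ p q, Subsumed p q → q ∈ L → p ∈ L

/-- The prefix quotient `p \ L`. -/
def prefixQuotient (p : Ipomset A) (L : Set (Ipomset A)) : Set (Ipomset A) :=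
  {q | ∃ r ∈ L, Glues p q r}

/-- The suffix quotient `L / p`. -/
def suffixQuotient (L : Set (Ipomset A)) (p : Ipomset A) : Set (Ipomset A) :=
  {q | ∃ r ∈ L, Glues q p r}

/-- The set of all prefix quotients of `L`. -/
def prefixQuotients (L : Set (Ipomset A)) : Set (Set (Ipomset A)) :=
  {M | ∃ p : Ipomset A, M = prefixQuotient p L}

/-- The set of all suffix quotients of `L`. -/
def suffixQuotients (L : Set (Ipomset A)) : Set (Set (Ipomset A)) :=
  {M | ∃ p : Ipomset A, M = suffixQuotient L p}

end Ipomset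

/-! ### Higher-dimensional automata -/

/-- Isomorphism classes of losets (finite, totally ordered, labelled sets) are lists of labels.
A `SubLoset V U` presents `V` as the sub-loset `U - E` of `U` which remains after removing a set
`E` of positions: it is the order and label preserving inclusion of `V`.  Each set `E` of positions
of `U` arises from exactly one `V` and one inclusion. -/
structure SubLoset {A : Type*} (V U : List A) where
  incl : Fin V.length ↪o Fin U.length
  label_incl : ∀ i, U.get (incl i) = V.get i

namespace SubLoset

variable {A : Type*} {U V W : List A}

/-- The set of positions of `U` that remain. -/
def kept (f : SubLoset V U) : Set (Fin U.length) := Set.range f.incl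

/-- `U` as a sub-loset of itself: nothing is removed. -/
def refl (U : List A) : SubLoset U U := ⟨RelEmbedding.refl _, fun _ => rfl⟩

/-- Removing events in two stages. -/
def trans (g : SubLoset W V) (f : SubLoset V U) : SubLoset W U :=
  ⟨g.incl.trans f.incl, fun i => (f.label_incl (g.incl i)).trans (g.label_incl i)⟩

end SubLoset

/-- A higher-dimensional automaton over `A`: a precubical set with start and accept cells.
`cell U` is the set of cells whose list of active events is `U`; for `f : SubLoset V U`, that is
`V = U - E`, the map `face ν f` is the face map `δ_E^ν`, lower for `ν = 0` and upper for `ν = 1`. -/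
structure HDA (A : Type*) where
  cell : List A → Type*
  face : Fin 2 → {U V : List A} → SubLoset V U → cell U → cell V
  /-- `δ_∅^ν = id`. -/
  face_refl : ∀ (ν : Fin 2) (U : List A) (x : cell U), face ν (SubLoset.refl U) x = x
  /-- `δ_E^ν δ_F^ν = δ_{E ∪ F}^ν` for disjoint `E`, `F`. -/
  face_trans : ∀ (ν : Fin 2) (U V W : List A) (f : SubLoset V U) (g : SubLoset W V) (x : cell U),
    face ν g (face ν f x) = face ν (g.trans f) x
  /-- `δ_E^ν δ_F^μ = δ_F^μ δ_E^ν` for disjoint `E`, `F`; here `V = U - F`, `V' = U - E` and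
  `W = U - (E ∪ F)`. -/
  face_comm : ∀ (ν μ : Fin 2) (U V V' W : List A) (f : SubLoset V U) (g : SubLoset W V)
    (f' : SubLoset V' U) (g' : SubLoset W V') (x : cell U),
    f.kept ∪ f'.kept = Set.univ → (g.trans f).kept = f.kept ∩ f'.kept →
    (g'.trans f').kept = f.kept ∩ f'.kept →
    face ν g (face μ f x) = face μ g' (face ν f' x)
  start : Set ((U : List A) × cell U)
  accept : Set ((U : List A) × cell U)

namespace HDA

variable {A : Type*}

/-- All cells of an HDA. -/
abbrev Cell (X : HDA A) := (U : List A) × X.cell U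

/-- The list of active events of a cell. -/
def ev (X : HDA A) (x : X.Cell) : List A := x.1

/-- Single steps: an upstep `δ_E^0 x ↗ x` starts the events in `E`, a downstep `x ↘ δ_E^1 x`
terminates them. -/
inductive Step (X : HDA A) : X.Cell → X.Cell → Type _
  | up {U V : List A} (f : SubLoset V U) (x : X.cell U) : Step X ⟨V, X.face 0 f x⟩ ⟨U, x⟩
  | down {U V : List A} (f : SubLoset V U) (x : X.cell U) : Step X ⟨U, x⟩ ⟨V, X.face 1 f x⟩

/-- Paths: sequences of consecutive steps. -/
inductive Path (X : HDA A) : X.Cell → X.Cell → Type _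
  | nil (x : X.Cell) : Path X x x
  | cons {x y z : X.Cell} (s : Step X x y) (α : Path X y z) : Path X x z

/-- The ipomset of a step: the starter `_{U-E}U_U` or the terminator `_U U_{U-E}`. -/
def Step.event {X : HDA A} {x y : X.Cell} : Step X x y → Ipomset A
  | @Step.up _ _ U _ f _ => Ipomset.mk (Iposet.discrete U f.kept Set.univ)
  | @Step.down _ _ U _ f _ => Ipomset.mk (Iposet.discrete U Set.univ f.kept)

/-- `p` is the event ipomset of the path `α`: the identity ipomset on the active events if `α` has
no steps, and otherwise the gluing of the ipomsets of its steps. -/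
def Path.HasEvent {X : HDA A} {x y : X.Cell} : Path X x y → Ipomset A → Prop
  | .nil x, p => p = Ipomset.mk (Iposet.discrete (X.ev x) Set.univ Set.univ)
  | .cons s α, p => ∃ q, α.HasEvent q ∧ Ipomset.Glues s.event q p

/-- The language of an HDA: the event ipomsets of its accepting paths. -/
def language (X : HDA A) : Set (Ipomset A) :=
  {p | ∃ x ∈ X.start, ∃ y ∈ X.accept, ∃ α : Path X x y, α.HasEvent p}

end HDA

/-- A language is regular if it is the language of an HDA with finitely many cells. -/
def Ipomset.IsRegular {A : Type u} (L : Set (Ipomset A)) : Prop :=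
  ∃ X : HDA.{u, u} A, Finite X.Cell ∧ X.language = L

/-!
A cut of an iposet `R` is a pair of sets `I`, `K` of events, covering `R`, such that the events in
`I \ K` precede those in `K \ I` and the events in `I ∩ K` are maximal in `I` and minimal in `K`.
Since only the event order of concurrent events matters, gluings are the same as cuts
(`Ipomset.glues_iff`): `r = p * q` if and only if `p` and `q` are the two sides of a cut of `r`.
All arguments take place inside one fixed iposet and compare restrictions of it
(`Iposet.Part`).  In particular gluing is associative, it is deterministic because a set of
concurrent events has only one listing in event order, and it is defined whenever the interfaces
are the same list (`Ipomset.exists_glues`).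

The relation "`p * q` is defined and in `L`" has the prefix quotients as its rows and the suffix
quotients as its columns.  A relation with finitely many rows has finitely many columns, so it
suffices to treat prefix quotients.

If `X` is an automaton with finitely many cells, then every path with event ipomset `p * q` can be
replaced by a path for `p` followed by one for `q` (`HDA.Path.exists_factorization`).  The given
path may pass by the cut, but only while it executes a series of upsteps or a series of downsteps, and
such a series may be executed in any order.  So the prefix quotient by `p` depends only on the set
of cells that are reached by paths for `p`, and there are finitely many such sets.

Conversely, let `L` have finitely many prefix quotients.  For an iposet `P` with target interface `U`
and a set `B ⊆ U`, let `P - B` be `P` with the events in `B` removed; it is undefined if `B` contains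
source events.  The cells over `U` of the automaton `nerodeHDA` are the families of quotients
`B ↦ (P - B) \ L` (`Ipomset.quotientData`).  Lower faces remove target events from `P`, and upper
faces remove them from the target interface of `P`.  Elements of a quotient `P \ L` have as many
source events as `P` has target events, so only finitely many `U` matter.

The automaton accepts every `R ∈ L`, since `R` can be decomposed into starters and terminators of
single events: if no unstarted event is minimal, then the active event whose interval ends first
precedes all unstarted ones (`Iposet.exists_prec_all`).  It accepts nothing else, because along every
path labelled `p` from a cell with quotient `M` to a cell with quotient `M'`, `q ∈ M'` implies
`p * q ∈ M`.  For downsteps this is associativity.  For upsteps it is the closure of `L` under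
subsumption: starting the events in `B` again after removing them yields an ipomset subsumed by `P`
(`Ipomset.exists_glues_subsumed`).
-/

namespace Iposet

variable {A α β γ : Type*}

/-! ### Restrictions of iposets -/

/-- `P` embeds into `R` along `e`, with image `I`; the interfaces of `P` are mapped to `S` and `T`,
which need not be the interfaces of `R`.  As for isomorphisms, the event order has to be preserved
on concurrent events only. -/
structure IsEmb (P : Iposet A α) (R : Iposet A γ) (e : α → γ) (I S T : Set γ) : Prop where
  inj : Function.Injective e
  range : Set.range e = I
  source : e '' P.source = S
  target : e '' P.target = T
  label : ∀ x, R.label (e x) = P.label x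
  prec : ∀ x y, P.prec x y ↔ R.prec (e x) (e y)
  evord : ∀ x y, P.Concurrent x y → (P.evord x y ↔ R.evord (e x) (e y))

theorem evord_asymm (P : Iposet A α) {x y : α} (h : P.evord x y) : ¬ P.evord y x :=
  fun h' => P.evord_irrefl _ (P.evord_trans _ _ _ h h')

theorem prec_asymm (P : Iposet A α) {x y : α} (h : P.prec x y) : ¬ P.prec y x :=
  fun h' => P.prec_irrefl _ (P.prec_trans _ _ _ h h')

/-- The event order has to be checked in one direction only, since it is total on pairs of
concurrent events. -/
theorem IsEmb.of_evord_imp {P : Iposet A α} {R : Iposet A γ} {e : α → γ} {I S T : Set γ}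
    (inj : Function.Injective e) (range : Set.range e = I) (source : e '' P.source = S)
    (target : e '' P.target = T) (label : ∀ x, R.label (e x) = P.label x)
    (prec : ∀ x y, P.prec x y ↔ R.prec (e x) (e y))
    (evord : ∀ x y, P.Concurrent x y → P.evord x y → R.evord (e x) (e y)) :
    IsEmb P R e I S T := by
  refine ⟨inj, range, source, target, label, prec, fun x y h => ⟨evord x y h, fun h' => ?_⟩⟩
  have hne : x ≠ y := by rintro rfl; exact R.evord_irrefl _ h'
  rcases P.related x y hne with h1 | h1 | h1 | h1
  · exact absurd h1 h.1
  · exact absurd h1 h.2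
  · exact h1
  · exact absurd h' (R.evord_asymm (evord y x h.symm h1))

theorem IsEmb.comp {P : Iposet A α} {Q : Iposet A β} {R : Iposet A γ} {e : α → β} {e' : β → γ}
    {K S' T' : Set β} {I S T : Set γ} (h : IsEmb P Q e K S' T') (h' : IsEmb Q R e' I S T) :
    IsEmb P R (e' ∘ e) (e' '' K) (e' '' S') (e' '' T') where
  inj := h'.inj.comp h.inj
  range := by rw [Set.range_comp, h.range]
  source := by rw [Set.image_comp, h.source]
  target := by rw [Set.image_comp, h.target]
  label x := by simp [h'.label, h.label]
  prec x y := by simp [h.prec, h'.prec]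
  evord x y hc := (h.evord x y hc).trans
    (h'.evord _ _ (by simpa [Concurrent, h.prec] using hc))

/-- The ipomset `p` is the isomorphism class of the restriction of `R` to `I`, with source
interface `S` and target interface `T`. -/
def Part (R : Iposet A γ) (I S T : Set γ) (p : Ipomset A) : Prop :=
  ∃ (n : ℕ) (P : Iposet A (Fin n)) (e : Fin n → γ), p = Ipomset.mk P ∧ IsEmb P R e I S T

theorem Isomorphic.isEmb {P : Iposet A α} {Q : Iposet A β} (h : P.Isomorphic Q) :
    ∃ e : α → β, IsEmb P Q e Set.univ Q.source Q.target := by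
  obtain ⟨f, hS, hT, hl, hp, he⟩ := h
  exact ⟨f, f.injective, f.surjective.range_eq, hS, hT, hl, hp, he⟩

theorem IsEmb.isomorphic {P : Iposet A α} {Q : Iposet A β} {e : α → β}
    (h : IsEmb P Q e Set.univ Q.source Q.target) : P.Isomorphic Q :=
  ⟨Equiv.ofBijective e ⟨h.inj, Set.range_eq_univ.1 h.range⟩, h.source, h.target, h.label, h.prec,
    h.evord⟩

theorem IsEmb.part {n : ℕ} {P : Iposet A (Fin n)} {R : Iposet A γ} {e : Fin n → γ} {I S T : Set γ}
    (h : IsEmb P R e I S T) : R.Part I S T (Ipomset.mk P) := ⟨n, P, e, rfl, h⟩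

theorem mk_eq_mk {m n : ℕ} {P : Iposet A (Fin m)} {Q : Iposet A (Fin n)} :
    Ipomset.mk P = Ipomset.mk Q ↔ P.Isomorphic Q :=
  ⟨fun h => Quotient.exact h, fun h => Quotient.sound (s := FinIposet.setoid A) h⟩

theorem part_univ {n : ℕ} (R : Iposet A (Fin n)) :
    R.Part Set.univ R.source R.target (Ipomset.mk R) :=
  ⟨n, R, id, rfl, Function.injective_id, by simp, by simp, by simp, by simp, by simp, by simp⟩

/-- Embeddings with the same image and interfaces differ by an isomorphism. -/
theorem IsEmb.exists_lift {P : Iposet A α} {Q : Iposet A β} {R : Iposet A γ} {e : α → γ}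
    {e' : β → γ} {I S T K S' T' : Set γ} (h : IsEmb P R e K S' T') (h' : IsEmb Q R e' I S T)
    (hK : K ⊆ I) :
    ∃ f : α → β, e' ∘ f = e ∧ IsEmb P Q f (e' ⁻¹' K) (e' ⁻¹' S') (e' ⁻¹' T') := by
  have : ∀ x, ∃ y, e' y = e x := fun x => by
    have : e x ∈ I := hK (h.range ▸ Set.mem_range_self x)
    rwa [← h'.range] at this
  choose f hf using this
  have hf' : e' ∘ f = e := funext hf
  refine ⟨f, hf', ?_, ?_, ?_, ?_, ?_, ?_, ?_⟩
  · exact Function.Injective.of_comp (f := e') (hf' ▸ h.inj)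
  · rw [← h.range, ← hf', Set.range_comp, h'.inj.preimage_image]
  · rw [← h.source, ← hf', Set.image_comp, h'.inj.preimage_image]
  · rw [← h.target, ← hf', Set.image_comp, h'.inj.preimage_image]
  · intro x; rw [← h'.label, hf, h.label]
  · intro x y; rw [h'.prec, hf, hf, h.prec]
  · intro x y hc
    rw [h'.evord, hf, hf, h.evord x y hc]
    simpa [Concurrent, h'.prec, hf, h.prec] using hc

theorem Part.unique {R : Iposet A γ} {I S T : Set γ} {p q : Ipomset A} (hp : R.Part I S T p)
    (hq : R.Part I S T q) : p = q := by
  obtain ⟨m, P, e, rfl, h⟩ := hp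
  obtain ⟨n, Q, e', rfl, h'⟩ := hq
  obtain ⟨f, -, hf⟩ := h.exists_lift h' subset_rfl
  refine mk_eq_mk.2 (IsEmb.isomorphic (e := f) ?_)
  convert hf
  · rw [← h'.range, Set.preimage_range]
  · rw [← h'.source, h'.inj.preimage_image]
  · rw [← h'.target, h'.inj.preimage_image]

theorem Part.exists_isEmb {R : Iposet A γ} {I S T : Set γ} {n : ℕ} {P : Iposet A (Fin n)}
    (h : R.Part I S T (Ipomset.mk P)) : ∃ e, IsEmb P R e I S T := by
  obtain ⟨m, Q, e, hQ, h⟩ := h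
  obtain ⟨f, hf⟩ := (mk_eq_mk.1 hQ).isEmb
  refine ⟨e ∘ f, ?_⟩
  have := hf.comp h
  rwa [Set.image_univ, h.range, h.source, h.target] at this

theorem IsEmb.part_image {P : Iposet A α} {R : Iposet A γ} {e : α → γ} {I S T : Set γ}
    (h : IsEmb P R e I S T) {K S' T' : Set α} {q : Ipomset A} (hq : P.Part K S' T' q) :
    R.Part (e '' K) (e '' S') (e '' T') q := by
  obtain ⟨n, Q, f, rfl, hf⟩ := hq
  exact (hf.comp h).part

theorem IsEmb.part_preimage {P : Iposet A α} {R : Iposet A γ} {e : α → γ} {I S T : Set γ}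
    (h : IsEmb P R e I S T) {K S' T' : Set γ} {q : Ipomset A} (hK : K ⊆ I)
    (hq : R.Part K S' T' q) : P.Part (e ⁻¹' K) (e ⁻¹' S') (e ⁻¹' T') q := by
  obtain ⟨n, Q, f, rfl, hf⟩ := hq
  obtain ⟨g, -, hg⟩ := hf.exists_lift h hK
  exact hg.part

theorem IsEmb.source_subset {P : Iposet A α} {R : Iposet A γ} {e : α → γ} {I S T : Set γ}
    (h : IsEmb P R e I S T) : S ⊆ I := by
  rw [← h.source, ← h.range]; exact Set.image_subset_range _ _

theorem IsEmb.target_subset {P : Iposet A α} {R : Iposet A γ} {e : α → γ} {I S T : Set γ}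
    (h : IsEmb P R e I S T) : T ⊆ I := by
  rw [← h.target, ← h.range]; exact Set.image_subset_range _ _

theorem Part.source_subset {R : Iposet A γ} {I S T : Set γ} {p : Ipomset A}
    (h : R.Part I S T p) : S ⊆ I := by
  obtain ⟨n, P, e, rfl, h⟩ := h
  exact h.source_subset

theorem Part.target_subset {R : Iposet A γ} {I S T : Set γ} {p : Ipomset A}
    (h : R.Part I S T p) : T ⊆ I := by
  obtain ⟨n, P, e, rfl, h⟩ := h
  exact h.target_subset

theorem Part.not_prec_source {R : Iposet A γ} {I S T : Set γ} {p : Ipomset A}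
    (h : R.Part I S T p) {x y : γ} (hx : x ∈ S) (hy : y ∈ I) : ¬ R.prec y x := by
  obtain ⟨n, P, e, rfl, h⟩ := h
  rw [← h.source] at hx
  rw [← h.range] at hy
  obtain ⟨x, hx, rfl⟩ := hx
  obtain ⟨y, rfl⟩ := hy
  rw [← h.prec]
  exact P.source_minimal x hx y

theorem Part.not_target_prec {R : Iposet A γ} {I S T : Set γ} {p : Ipomset A}
    (h : R.Part I S T p) {x y : γ} (hx : x ∈ T) (hy : y ∈ I) : ¬ R.prec x y := by
  obtain ⟨n, P, e, rfl, h⟩ := h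
  rw [← h.target] at hx
  rw [← h.range] at hy
  obtain ⟨x, hx, rfl⟩ := hx
  obtain ⟨y, rfl⟩ := hy
  rw [← h.prec]
  exact P.target_maximal x hx y

/-- The restriction of an iposet along an injection, with prescribed interfaces. -/
def comap (R : Iposet A γ) (e : α → γ) (he : Function.Injective e) (S T : Set γ)
    (hS : ∀ x ∈ S, ∀ y ∈ Set.range e, ¬ R.prec y x)
    (hT : ∀ x ∈ T, ∀ y ∈ Set.range e, ¬ R.prec x y) : Iposet A α where
  prec x y := R.prec (e x) (e y)
  evord x y := R.evord (e x) (e y)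
  source := e ⁻¹' S
  target := e ⁻¹' T
  label := R.label ∘ e
  prec_irrefl _ := R.prec_irrefl _
  prec_trans _ _ _ := R.prec_trans _ _ _
  evord_irrefl _ := R.evord_irrefl _
  evord_trans _ _ _ := R.evord_trans _ _ _
  related x y h := R.related _ _ (he.ne h)
  interval := by
    obtain ⟨b, e', h, h'⟩ := R.interval
    exact ⟨b ∘ e, e' ∘ e, fun x => h _, fun x y => h' _ _⟩
  source_minimal x hx y := hS _ hx _ ⟨y, rfl⟩
  target_maximal x hx y := hT _ hx _ ⟨y, rfl⟩

theorem exists_part (R : Iposet A γ) {I S T : Set γ} (hI : I.Finite) (hS : S ⊆ I) (hT : T ⊆ I)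
    (hS' : ∀ x ∈ S, ∀ y ∈ I, ¬ R.prec y x) (hT' : ∀ x ∈ T, ∀ y ∈ I, ¬ R.prec x y) :
    ∃ p, R.Part I S T p := by
  have := hI.to_subtype
  obtain ⟨n, ⟨f⟩⟩ := Finite.exists_equiv_fin I
  have hr : Set.range (fun x => (f.symm x : γ)) = I := by
    ext x
    constructor
    · rintro ⟨y, rfl⟩; exact (f.symm y).2
    · intro h; exact ⟨f ⟨x, h⟩, by simp⟩
  refine ⟨_, IsEmb.part (P := R.comap (fun x => (f.symm x : γ))
    (Subtype.val_injective.comp f.symm.injective) S T (by rwa [hr]) (by rwa [hr]))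
    (e := fun x => (f.symm x : γ)) ?_⟩
  refine ⟨Subtype.val_injective.comp f.symm.injective, hr, ?_, ?_, fun _ => rfl,
    fun _ _ => Iff.rfl, fun _ _ _ => Iff.rfl⟩
  · exact Set.image_preimage_eq_of_subset (by rwa [hr])
  · exact Set.image_preimage_eq_of_subset (by rwa [hr])

/-! ### Gluings as cuts -/

/-- The events in `J`, with source interface `S` and target interface `T`, are split into a
prefix with events `I` and a suffix with events `K`; the events in `I ∩ K` are active at the cut.
That these are maximal in `I` and minimal in `K` is not part of the definition; it holds whenever
`I ∩ K` is an interface of the two restrictions. -/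
structure IsCut (R : Iposet A γ) (J S T I K : Set γ) : Prop where
  union : I ∪ K = J
  source : S ⊆ I
  target : T ⊆ K
  prec : ∀ x ∈ I, x ∉ K → ∀ y ∈ K, y ∉ I → R.prec x y

theorem IsGluingVia.left_isEmb {P : Iposet A α} {Q : Iposet A β} {R : Iposet A γ} {i : α → γ}
    {j : β → γ} (h : IsGluingVia P Q R i j) :
    IsEmb P R i (Set.range i) R.source (Set.range i ∩ Set.range j) := by
  refine .of_evord_imp h.left_injective rfl h.source_eq.symm ?_ h.label_left ?_ ?_
  · ext u
    constructor
    · rintro ⟨x, hx, rfl⟩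
      obtain ⟨y, -, hy⟩ := h.left_match x hx
      exact ⟨⟨x, rfl⟩, y, hy.symm⟩
    · rintro ⟨⟨x, rfl⟩, y, hy⟩
      exact ⟨x, (h.overlap x y hy.symm).1, rfl⟩
  · intro x x'
    rw [h.prec_iff]
    constructor
    · exact fun hx => Or.inl ⟨x, x', hx, rfl, rfl⟩
    · rintro (⟨a, b, hab, ha, hb⟩ | ⟨a, b, hab, ha, hb⟩ | ⟨a, b, ha, hb, -, hb'⟩)
      · rwa [← h.left_injective ha, ← h.left_injective hb]
      · exact absurd hab (Q.source_minimal _ (h.overlap _ _ hb.symm).2 _)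
      · exact absurd (h.overlap _ _ hb'.symm).2 hb
  · intro x x' _ hx
    exact (h.evord_iff _ _).2 (.single (Or.inl ⟨x, x', hx, rfl, rfl⟩))

theorem IsGluingVia.right_isEmb {P : Iposet A α} {Q : Iposet A β} {R : Iposet A γ} {i : α → γ}
    {j : β → γ} (h : IsGluingVia P Q R i j) :
    IsEmb Q R j (Set.range j) (Set.range i ∩ Set.range j) R.target := by
  refine .of_evord_imp h.right_injective rfl ?_ h.target_eq.symm h.label_right ?_ ?_
  · ext u
    constructor
    · rintro ⟨y, hy, rfl⟩
      obtain ⟨x, -, hx⟩ := h.right_match y hy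
      exact ⟨⟨x, hx⟩, y, rfl⟩
    · rintro ⟨⟨x, rfl⟩, y, hy⟩
      exact ⟨y, (h.overlap x y hy.symm).2, hy⟩
  · intro x x'
    rw [h.prec_iff]
    constructor
    · exact fun hx => Or.inr (Or.inl ⟨x, x', hx, rfl, rfl⟩)
    · rintro (⟨a, b, hab, ha, hb⟩ | ⟨a, b, hab, ha, hb⟩ | ⟨a, b, ha, hb, ha', -⟩)
      · exact absurd hab (P.target_maximal _ (h.overlap _ _ ha).1 _)
      · rwa [← h.right_injective ha, ← h.right_injective hb]
      · exact absurd (h.overlap _ _ ha').1 ha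
  · intro x x' _ hx
    exact (h.evord_iff _ _).2 (.single (Or.inr ⟨x, x', hx, rfl, rfl⟩))

theorem IsGluingVia.isCut {P : Iposet A α} {Q : Iposet A β} {R : Iposet A γ} {i : α → γ}
    {j : β → γ} (h : IsGluingVia P Q R i j) :
    R.IsCut Set.univ R.source R.target (Set.range i) (Set.range j) := by
  refine ⟨h.cover, ?_, ?_, ?_⟩
  · rw [h.source_eq]; exact Set.image_subset_range _ _
  · rw [h.target_eq]; exact Set.image_subset_range _ _
  · rintro _ ⟨x, rfl⟩ hx _ ⟨y, rfl⟩ hy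
    refine (h.prec_iff _ _).2 (Or.inr (Or.inr ⟨x, y, fun hx' => ?_, fun hy' => ?_, rfl, rfl⟩))
    · obtain ⟨y, -, hy⟩ := h.left_match x hx'
      exact hx ⟨y, hy.symm⟩
    · obtain ⟨x, -, hx⟩ := h.right_match y hy'
      exact hy ⟨x, hx⟩

theorem IsCut.image {P : Iposet A α} {R : Iposet A γ} {e : α → γ} {I S T : Set γ}
    (h : IsEmb P R e I S T) {J' S' T' I' K' : Set α} (hc : P.IsCut J' S' T' I' K') :
    R.IsCut (e '' J') (e '' S') (e '' T') (e '' I') (e '' K') := by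
  refine ⟨by rw [← Set.image_union, hc.union], Set.image_mono hc.source,
    Set.image_mono hc.target, ?_⟩
  rintro _ ⟨x, hx, rfl⟩ hx' _ ⟨y, hy, rfl⟩ hy'
  rw [← h.prec]
  exact hc.prec x hx (fun h => hx' ⟨x, h, rfl⟩) y hy (fun h => hy' ⟨y, h, rfl⟩)

/-- An iposet with the event order replaced by a smaller one, which is still total on pairs of
concurrent events. -/
def withEvord (R : Iposet A α) (E : α → α → Prop) (h : ∀ x y, E x y → R.evord x y)
    (trans : ∀ x y z, E x y → E y z → E x z)
    (h' : ∀ x y, R.evord x y → R.prec x y ∨ R.prec y x ∨ E x y) : Iposet A α :=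
  { R with
    evord := E
    evord_irrefl := fun x hx => R.evord_irrefl x (h x x hx)
    evord_trans := trans
    related := fun x y hxy => by
      rcases R.related x y hxy with h1 | h1 | h1 | h1
      · exact Or.inl h1
      · exact Or.inr (Or.inl h1)
      · rcases h' x y h1 with h2 | h2 | h2 <;> simp [h2]
      · rcases h' y x h1 with h2 | h2 | h2 <;> simp [h2] }

theorem withEvord_isomorphic (R : Iposet A α) (E : α → α → Prop) (h : ∀ x y, E x y → R.evord x y)
    (trans : ∀ x y z, E x y → E y z → E x z)
    (h' : ∀ x y, R.evord x y → R.prec x y ∨ R.prec y x ∨ E x y) :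
    R.Isomorphic (R.withEvord E h trans h') := by
  refine ⟨Equiv.refl _, by simp [withEvord], by simp [withEvord], fun _ => rfl,
    fun _ _ => Iff.rfl, fun x y hc => ⟨fun hxy => ?_, fun hxy => h _ _ hxy⟩⟩
  rcases h' x y hxy with h2 | h2 | h2
  · exact absurd h2 hc.1
  · exact absurd h2 hc.2
  · exact h2

theorem IsEmb.comap_isomorphic {P : Iposet A α} {R : Iposet A γ} {e : α → γ} {I S T : Set γ}
    (h : IsEmb P R e I S T) (hS hT) : P.Isomorphic (R.comap e h.inj S T hS hT) := by
  refine ⟨Equiv.refl _, ?_, ?_, fun x => h.label x, h.prec, h.evord⟩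
  · simp [comap, ← h.source, h.inj.preimage_image]
  · simp [comap, ← h.target, h.inj.preimage_image]

end Iposet

open Iposet

namespace Ipomset

variable {A α β γ : Type*}

/-- Gluings correspond to cuts: `r = p * q` if and only if `p` and `q` are the two sides of a cut
of `r`. -/
theorem glues_iff {R : Iposet A γ} {J S T : Set γ} {p q r : Ipomset A} (hr : R.Part J S T r) :
    Glues p q r ↔ ∃ I K, R.IsCut J S T I K ∧ R.Part I S (I ∩ K) p ∧ R.Part K (I ∩ K) T q := by
  constructor
  · rintro ⟨k, m, n, P, Q, R0, rfl, rfl, rfl, i, j, h⟩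
    obtain ⟨e, he⟩ := hr.exists_isEmb
    refine ⟨e '' Set.range i, e '' Set.range j, ?_, ?_, ?_⟩
    · have := h.isCut.image he
      rwa [Set.image_univ, he.range, he.source, he.target] at this
    · have := (h.left_isEmb.comp he).part
      rwa [he.source, Set.image_inter he.inj] at this
    · have := (h.right_isEmb.comp he).part
      rwa [he.target, Set.image_inter he.inj] at this
  · rintro ⟨I, K, hc, hp, hq⟩
    obtain ⟨k, P, e, rfl, he⟩ := hp
    obtain ⟨m, Q, e', rfl, he'⟩ := hq
    obtain ⟨n, R0, e0, rfl, h0⟩ := hr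
    obtain ⟨i, hi, hi'⟩ := he.exists_lift h0 (hc.union ▸ Set.subset_union_left)
    obtain ⟨j, hj, hj'⟩ := he'.exists_lift h0 (hc.union ▸ Set.subset_union_right)
    have hpS : ∀ x ∈ S, ∀ y ∈ Set.range e, ¬ R.prec y x := by
      rw [he.range]; exact fun x hx y hy => he.part.not_prec_source hx hy
    have hpT : ∀ x ∈ I ∩ K, ∀ y ∈ Set.range e, ¬ R.prec x y := by
      rw [he.range]; exact fun x hx y hy => he.part.not_target_prec hx hy
    have hqS : ∀ x ∈ I ∩ K, ∀ y ∈ Set.range e', ¬ R.prec y x := by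
      rw [he'.range]; exact fun x hx y hy => he'.part.not_prec_source hx hy
    have hqT : ∀ x ∈ T, ∀ y ∈ Set.range e', ¬ R.prec x y := by
      rw [he'.range]; exact fun x hx y hy => he'.part.not_target_prec hx hy
    have hi0 : ∀ x, e0 (i x) = e x := fun x => congrFun hi x
    have hj0 : ∀ x, e0 (j x) = e' x := fun x => congrFun hj x
    have hiI : ∀ x, e x ∈ I := fun x => he.range ▸ Set.mem_range_self x
    have hjK : ∀ x, e' x ∈ K := fun x => he'.range ▸ Set.mem_range_self x
    have hov : ∀ x, e x ∈ K → ∃ y, i x = j y := fun x hx => by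
      rw [← he'.range] at hx
      obtain ⟨y, hy⟩ := hx
      exact ⟨y, h0.inj (by rw [hi0, hj0, hy])⟩
    have hov' : ∀ y, e' y ∈ I → ∃ x, i x = j y := fun y hy => by
      rw [← he.range] at hy
      obtain ⟨x, hx⟩ := hy
      exact ⟨x, h0.inj (by rw [hi0, hj0, hx])⟩
    have hoverlap : ∀ x y, i x = j y → e x ∈ I ∩ K ∧ e' y ∈ I ∩ K := fun x y hxy => by
      have : e x = e' y := by rw [← hi0, ← hj0, hxy]
      exact ⟨⟨hiI x, this ▸ hjK y⟩, this ▸ hiI x, hjK y⟩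
    have hcov : ∀ u, (∃ x, i x = u) ∨ ∃ y, j y = u := fun u => by
      have : e0 u ∈ I ∪ K := by rw [hc.union, ← h0.range]; exact Set.mem_range_self u
      rw [← he.range, ← he'.range] at this
      rcases this with ⟨x, hx⟩ | ⟨x, hx⟩
      · exact Or.inl ⟨x, h0.inj (by rw [hi0, hx])⟩
      · exact Or.inr ⟨x, h0.inj (by rw [hj0, hx])⟩
    -- All event orders are inherited from the ambient iposet `R`, so that the transitive closure
    -- in the definition of gluings cannot create cycles.
    let P' := R.comap e he.inj S (I ∩ K) hpS hpT
    let Q' := R.comap e' he'.inj (I ∩ K) T hqS hqT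
    have hS0 : ∀ x ∈ S, ∀ y ∈ Set.range e0, ¬ R.prec y x := by
      rw [h0.range]; exact fun x hx y hy => h0.part.not_prec_source hx hy
    have hT0 : ∀ x ∈ T, ∀ y ∈ Set.range e0, ¬ R.prec x y := by
      rw [h0.range]; exact fun x hx y hy => h0.part.not_target_prec hx hy
    let R1 := R.comap e0 h0.inj S T hS0 hT0
    let E : Fin n → Fin n → Prop := Relation.TransGen
      (fun u v => Relation.Map P'.evord i i u v ∨ Relation.Map Q'.evord j j u v)
    have hE : ∀ u v, E u v → R1.evord u v := by
      intro u v huv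
      have hstep : ∀ u v, (Relation.Map P'.evord i i u v ∨ Relation.Map Q'.evord j j u v) →
          R1.evord u v := by
        rintro u v (⟨a, b, hab, rfl, rfl⟩ | ⟨a, b, hab, rfl, rfl⟩)
        · change R.evord (e0 (i a)) (e0 (i b))
          rw [hi0, hi0]; exact hab
        · change R.evord (e0 (j a)) (e0 (j b))
          rw [hj0, hj0]; exact hab
      induction huv with
      | single h => exact hstep _ _ h
      | tail _ h ih => exact R1.evord_trans _ _ _ ih (hstep _ _ h)
    have hE' : ∀ u v, R1.evord u v → R1.prec u v ∨ R1.prec v u ∨ E u v := by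
      intro u v huv
      have key : ∀ u v, (∃ x, i x = u) → (∃ y, j y = v) → (¬ ∃ y, j y = u) → (¬ ∃ x, i x = v) →
          R1.prec u v := by
        rintro _ _ ⟨x, rfl⟩ ⟨y, rfl⟩ h1 h2
        change R.prec (e0 (i x)) (e0 (j y))
        rw [hi0, hj0]
        exact hc.prec _ (hiI x) (fun h => h1 ((hov x h).imp fun _ => Eq.symm)) _ (hjK y)
          (fun h => h2 (hov' y h))
      by_cases h1 : (∃ x, i x = u) ∧ ∃ x, i x = v
      · obtain ⟨⟨x, rfl⟩, y, rfl⟩ := h1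
        refine Or.inr (Or.inr (.single (Or.inl ⟨x, y, ?_, rfl, rfl⟩)))
        change R.evord (e0 (i x)) (e0 (i y)) at huv
        rwa [hi0, hi0] at huv
      by_cases h2 : (∃ x, j x = u) ∧ ∃ x, j x = v
      · obtain ⟨⟨x, rfl⟩, y, rfl⟩ := h2
        refine Or.inr (Or.inr (.single (Or.inr ⟨x, y, ?_, rfl, rfl⟩)))
        change R.evord (e0 (j x)) (e0 (j y)) at huv
        rwa [hj0, hj0] at huv
      rcases hcov u with h3 | h3 <;> rcases hcov v with h4 | h4
      · exact absurd ⟨h3, h4⟩ h1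
      · exact Or.inl (key u v h3 h4 (fun h => h2 ⟨h, h4⟩) (fun h => h1 ⟨h3, h⟩))
      · exact Or.inr (Or.inl (key v u h4 h3 (fun h => h2 ⟨h3, h⟩) (fun h => h1 ⟨h, h4⟩)))
      · exact absurd ⟨h3, h4⟩ h2
    refine ⟨k, m, n, P', Q', R1.withEvord E hE (fun _ _ _ => Relation.TransGen.trans) hE',
      mk_eq_mk.2 (he.comap_isomorphic hpS hpT), mk_eq_mk.2 (he'.comap_isomorphic hqS hqT),
      mk_eq_mk.2 ((h0.comap_isomorphic hS0 hT0).trans (withEvord_isomorphic _ _ _ _ _)), i, j, ?_⟩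
    refine ⟨hi'.inj, hj'.inj, ?_, hoverlap, ?_, ?_, ?_, ?_, ?_, ?_, ?_, fun _ _ => Iff.rfl, ?_⟩
    · ext u; simpa using hcov u
    · intro x hx
      obtain ⟨y, hy⟩ := hov x hx.2
      exact ⟨y, (hoverlap _ _ hy).2, hy⟩
    · intro y hy
      obtain ⟨x, hx⟩ := hov' y hy.1
      exact ⟨x, (hoverlap _ _ hx).1, hx⟩
    · intro x y x' y' h h'
      change R.evord (e x) (e x') ↔ R.evord (e' y) (e' y')
      rw [← hi0, ← hi0, ← hj0, ← hj0, h, h']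
    · intro x
      change R.label (e0 (i x)) = R.label (e x)
      rw [hi0]
    · intro x
      change R.label (e0 (j x)) = R.label (e' x)
      rw [hj0]
    · change e0 ⁻¹' S = i '' (e ⁻¹' S)
      rw [← hi, Set.preimage_comp, Set.image_preimage_eq_inter_range, hi'.range,
        ← Set.preimage_inter, Set.inter_eq_left.2 hc.source]
    · change e0 ⁻¹' T = j '' (e' ⁻¹' T)
      rw [← hj, Set.preimage_comp, Set.image_preimage_eq_inter_range, hj'.range,
        ← Set.preimage_inter, Set.inter_eq_left.2 hc.target]
    · intro u v
      change R.prec (e0 u) (e0 v) ↔ _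
      constructor
      · intro huv
        rcases hcov u with ⟨x, rfl⟩ | ⟨y, rfl⟩ <;> rcases hcov v with ⟨x', rfl⟩ | ⟨y', rfl⟩
        · rw [hi0, hi0] at huv
          exact Or.inl ⟨x, x', huv, rfl, rfl⟩
        · rw [hi0, hj0] at huv
          by_cases hx : e x ∈ K
          · obtain ⟨y, hy⟩ := hov x hx
            rw [← hi0, hy, hj0] at huv
            exact Or.inr (Or.inl ⟨y, y', huv, hy.symm, rfl⟩)
          by_cases hy : e' y' ∈ I
          · obtain ⟨x', hx'⟩ := hov' y' hy
            rw [← hj0, ← hx', hi0] at huv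
            exact Or.inl ⟨x, x', huv, rfl, hx'⟩
          exact Or.inr (Or.inr ⟨x, y', fun h => hx h.2, fun h => hy h.1, rfl, rfl⟩)
        · rw [hj0, hi0] at huv
          by_cases hy : e' y ∈ I
          · exact absurd huv (hpT _ ⟨hy, hjK y⟩ _ ⟨x', rfl⟩)
          by_cases hx : e x' ∈ K
          · exact absurd huv (hqS _ ⟨hiI _, hx⟩ _ ⟨y, rfl⟩)
          exact absurd huv (R.prec_asymm (hc.prec _ (hiI x') hx _ (hjK y) hy))
        · rw [hj0, hj0] at huv
          exact Or.inr (Or.inl ⟨y, y', huv, rfl, rfl⟩)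
      · rintro (⟨a, b, hab, rfl, rfl⟩ | ⟨a, b, hab, rfl, rfl⟩ | ⟨a, b, ha, hb, rfl, rfl⟩)
        · rw [hi0, hi0]; exact hab
        · rw [hj0, hj0]; exact hab
        · rw [hi0, hj0]
          exact hc.prec _ (hiI a) (fun h => ha ⟨hiI a, h⟩) _ (hjK b) (fun h => hb ⟨h, hjK b⟩)

end Ipomset

namespace Iposet

variable {A α β γ : Type*}

/-! ### Lists of concurrent events -/

/-- `e` enumerates pairwise concurrent events of `R` in event order, and `U` is the list of their
labels. -/
structure IsListing (R : Iposet A γ) (U : List A) (e : Fin U.length → γ) : Prop where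
  evord : ∀ i j, i < j → R.evord (e i) (e j)
  conc : ∀ i j, ¬ R.prec (e i) (e j)
  label : ∀ i, R.label (e i) = U.get i

theorem IsListing.injective {R : Iposet A γ} {U : List A} {e : Fin U.length → γ}
    (h : R.IsListing U e) : Function.Injective e := by
  intro i j hij
  by_contra hne
  rcases lt_or_gt_of_ne hne with h1 | h1
  · exact R.evord_irrefl (e j) (hij ▸ h.evord i j h1)
  · exact R.evord_irrefl (e j) (hij ▸ h.evord j i h1)

/-- A set of concurrent events has at most one listing. -/
theorem IsListing.unique {R : Iposet A γ} {U U' : List A} {e : Fin U.length → γ}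
    {e' : Fin U'.length → γ} (h : R.IsListing U e) (h' : R.IsListing U' e')
    (hr : Set.range e = Set.range e') :
    (⟨U, e⟩ : (U : List A) × (Fin U.length → γ)) = ⟨U', e'⟩ := by
  have hlen : U.length = U'.length := by
    have h1 := Set.ncard_image_of_injective Set.univ h.injective
    have h2 := Set.ncard_image_of_injective Set.univ h'.injective
    rw [Set.image_univ] at h1 h2
    rw [hr, h2] at h1
    simpa using h1.symm
  have hee : e = e' ∘ Fin.cast hlen := by
    have : IsStrictOrder γ R.evord :=
      { irrefl := R.evord_irrefl
        trans := R.evord_trans }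
    let := partialOrderOfSO R.evord
    refine (StrictMono.range_inj (f := e) (g := e' ∘ Fin.cast hlen) ?_ ?_).1 ?_
    · exact fun i j hij => h.evord i j hij
    · exact fun i j hij => h'.evord _ _ hij
    · rw [hr, Set.range_comp,
        show Set.range (Fin.cast hlen) = Set.univ from (finCongr hlen).surjective.range_eq,
        Set.image_univ]
  have hU : U = U' := by
    refine List.ext_get hlen fun n h1 h2 => ?_
    rw [← h.label, ← h'.label, hee]
    rfl
  subst hU
  rw [hee]
  rfl

theorem exists_isListing (R : Iposet A γ) {I : Set γ} (hI : I.Finite)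
    (hc : ∀ x ∈ I, ∀ y ∈ I, ¬ R.prec x y) : ∃ U e, R.IsListing U e ∧ Set.range e = I := by
  classical
  have : Fintype I := hI.fintype
  let r : I → I → Prop := fun x y => R.evord x y
  have : IsStrictTotalOrder I r :=
    { irrefl := fun x => R.evord_irrefl _
      trans := fun x y z => R.evord_trans _ _ _
      trichotomous := fun x y h1 h2 => by
        by_contra hne
        rcases R.related x y (fun h => hne (Subtype.ext h)) with h | h | h | h
        · exact hc _ x.2 _ y.2 h
        · exact hc _ y.2 _ x.2 h
        · exact h1 h
        · exact h2 h }
  let := linearOrderOfSTO r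
  let f := (Finset.univ : Finset I).orderEmbOfFin rfl
  have hlen : (List.ofFn fun i => R.label (f i)).length = (Finset.univ : Finset I).card := by simp
  refine ⟨List.ofFn fun i => R.label (f i), fun i => f (i.cast hlen), ⟨?_, ?_, ?_⟩, ?_⟩
  · intro i j hij
    exact f.strictMono (show i.cast hlen < j.cast hlen from hij)
  · exact fun i j => hc _ (f _).2 _ (f _).2
  · intro i
    rw [List.get_eq_getElem, List.getElem_ofFn]
    rfl
  · ext x
    constructor
    · rintro ⟨i, rfl⟩; exact (f _).2
    · intro hx
      have : (⟨x, hx⟩ : I) ∈ Set.range f := by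
        rw [Finset.range_orderEmbOfFin]; simp
      obtain ⟨i, hi⟩ := this
      exact ⟨i.cast hlen.symm, congrArg Subtype.val hi⟩

theorem IsEmb.isListing_comp {P : Iposet A α} {R : Iposet A γ} {e : α → γ} {I S T : Set γ}
    (h : IsEmb P R e I S T) {U : List A} {l : Fin U.length → α} :
    R.IsListing U (e ∘ l) ↔ P.IsListing U l := by
  constructor
  · intro hl
    have hc : ∀ i j, ¬ P.prec (l i) (l j) := fun i j => by rw [h.prec]; exact hl.conc i j
    exact ⟨fun i j hij => (h.evord _ _ ⟨hc i j, hc j i⟩).2 (hl.evord i j hij), hc,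
      fun i => by rw [← h.label]; exact hl.label i⟩
  · intro hl
    exact ⟨fun i j hij => (h.evord _ _ ⟨hl.conc i j, hl.conc j i⟩).1 (hl.evord i j hij),
      fun i j => by simpa [h.prec] using hl.conc i j,
      fun i => by simpa [h.label] using hl.label i⟩

theorem IsEmb.exists_lift_range {P : Iposet A α} {R : Iposet A γ} {e : α → γ} {I S T : Set γ}
    (h : IsEmb P R e I S T) {ι : Type*} {l : ι → γ} (hl : Set.range l ⊆ I) : ∃ l', l = e ∘ l' := by
  have : ∀ i, ∃ x, e x = l i := fun i => by
    have := hl ⟨i, rfl⟩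
    rwa [← h.range] at this
  choose l' h' using this
  exact ⟨l', funext fun i => (h' i).symm⟩

theorem IsListing.isEmb {R : Iposet A γ} {U : List A} {e : Fin U.length → γ}
    (h : R.IsListing U e) (S T : Set (Fin U.length)) :
    IsEmb (discrete U S T) R e (Set.range e) (e '' S) (e '' T) :=
  .of_evord_imp h.injective rfl rfl rfl h.label (fun x y => iff_of_false id (h.conc x y))
    fun x y _ hxy => h.evord x y hxy

/-- Restrictions which are isomorphic to a discrete iposet are given by listings. -/
theorem part_discrete_iff {R : Iposet A γ} {I S T : Set γ} {U : List A}
    {S' T' : Set (Fin U.length)} :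
    R.Part I S T (Ipomset.mk (discrete U S' T')) ↔
      ∃ e, R.IsListing U e ∧ Set.range e = I ∧ e '' S' = S ∧ e '' T' = T := by
  constructor
  · intro h
    obtain ⟨e, he⟩ := h.exists_isEmb
    refine ⟨e, ?_, he.range, he.source, he.target⟩
    exact (he.isListing_comp (l := id)).2 ⟨fun i j h => h, fun _ _ => id, fun _ => rfl⟩
  · rintro ⟨e, he, rfl, rfl, rfl⟩
    exact (he.isEmb S' T').part

theorem IsListing.comp_subLoset {R : Iposet A γ} {U V : List A} {e : Fin U.length → γ}
    (h : R.IsListing U e) (f : SubLoset V U) : R.IsListing V (e ∘ f.incl) :=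
  ⟨fun _ _ hij => h.evord _ _ (f.incl.strictMono hij), fun _ _ => h.conc _ _,
    fun i => (h.label _).trans (f.label_incl i)⟩

theorem range_comp_incl {U V : List A} (e : Fin U.length → γ) (f : SubLoset V U) :
    Set.range (e ∘ f.incl) = e '' f.kept := by
  rw [Set.range_comp]; rfl

/-- A listing of a smaller set factors through an inclusion of lists. -/
theorem IsListing.exists_subLoset {R : Iposet A γ} {U V : List A} {e : Fin U.length → γ}
    {e' : Fin V.length → γ} (h : R.IsListing U e) (h' : R.IsListing V e')
    (hr : Set.range e' ⊆ Set.range e) : ∃ f : SubLoset V U, e' = e ∘ f.incl := by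
  have : ∀ i, ∃ j, e j = e' i := fun i => hr ⟨i, rfl⟩
  choose f hf using this
  have hmono : StrictMono f := by
    intro i j hij
    by_contra hlt
    have h1 := h'.evord i j hij
    rw [← hf, ← hf] at h1
    rcases (not_lt.1 hlt).lt_or_eq with h2 | h2
    · exact R.evord_asymm h1 (h.evord _ _ h2)
    · rw [h2] at h1; exact R.evord_irrefl _ h1
  exact ⟨⟨OrderEmbedding.ofStrictMono f hmono, fun i => by
    rw [← h.label, ← h'.label, ← hf]; rfl⟩, funext fun i => (hf i).symm⟩

theorem IsListing.exists_restrict {R : Iposet A γ} {U : List A} {e : Fin U.length → γ}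
    (h : R.IsListing U e) {I : Set γ} (hI : I ⊆ Set.range e) :
    ∃ (V : List A) (f : SubLoset V U), e '' f.kept = I := by
  obtain ⟨V, e', he', rfl⟩ := R.exists_isListing ((Set.finite_range e).subset hI)
    (by
      intro x hx y hy
      obtain ⟨i, rfl⟩ := hI hx
      obtain ⟨j, rfl⟩ := hI hy
      exact h.conc i j)
  obtain ⟨f, rfl⟩ := h.exists_subLoset he' hI
  exact ⟨V, f, (range_comp_incl e f).symm⟩

theorem _root_.SubLoset.ext_of_comp {U V : List A} {e : Fin U.length → γ}
    (he : Function.Injective e) {f g : SubLoset V U} (h : e ∘ f.incl = e ∘ g.incl) : f = g := by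
  obtain ⟨f, hf⟩ := f
  obtain ⟨g, hg⟩ := g
  have : f = g := by
    ext i
    exact congrArg Fin.val (he (congrFun h i))
  subst this
  rfl

theorem discrete_isListing (U : List A) (S T : Set (Fin U.length)) :
    (discrete U S T).IsListing U id := ⟨fun _ _ h => h, fun _ _ => id, fun _ => rfl⟩

theorem _root_.SubLoset.ext_of_kept {U V : List A} {f g : SubLoset V U} (h : f.kept = g.kept) :
    f = g := by
  have hU := discrete_isListing U ∅ ∅
  have := (hU.comp_subLoset f).unique (hU.comp_subLoset g) (by
    rw [range_comp_incl, range_comp_incl, h])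
  exact SubLoset.ext_of_comp Function.injective_id (eq_of_heq (Sigma.mk.inj this).2)

end Iposet

namespace Ipomset

variable {A α β γ : Type*}

/-! ### Gluing is associative and deterministic -/

theorem exists_rep (p : Ipomset A) : ∃ (n : ℕ) (P : Iposet A (Fin n)), p = mk P := by
  obtain ⟨⟨n, P⟩, rfl⟩ := Quotient.exists_rep p
  exact ⟨n, P, rfl⟩

theorem Glues.assoc_right {s q p t r : Ipomset A} (h1 : Glues s q p) (h2 : Glues p t r) :
    ∃ u, Glues q t u ∧ Glues s u r := by
  obtain ⟨n, R, rfl⟩ := r.exists_rep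
  have hr := part_univ R
  obtain ⟨I, K, hc, hp, ht⟩ := (glues_iff hr).1 h2
  obtain ⟨I1, K1, hc1, hs, hq⟩ := (glues_iff hp).1 h1
  obtain ⟨hu, hS, hT, hprec⟩ := hc
  obtain ⟨hu1, hS1, hT1, hprec1⟩ := hc1
  have hI1 : I1 ⊆ I := hu1 ▸ Set.subset_union_left
  have hK1 : K1 ⊆ I := hu1 ▸ Set.subset_union_right
  have hK1K : K1 ∩ K = I ∩ K := by
    ext x
    exact ⟨fun h => ⟨hK1 h.1, h.2⟩, fun h => ⟨hT1 h, h.2⟩⟩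
  have hcut : R.IsCut (K1 ∪ K) (I1 ∩ K1) R.target K1 K := by
    refine ⟨rfl, Set.inter_subset_right, hT, fun x hx hxK y hy hyK => hprec x (hK1 hx) hxK y hy ?_⟩
    exact fun h => hyK (hT1 ⟨h, hy⟩)
  obtain ⟨u, hu'⟩ := R.exists_part (I := K1 ∪ K) (S := I1 ∩ K1) (T := R.target) (Set.toFinite _)
    (fun x hx => Or.inl hx.2) (fun x hx => Or.inr (hT hx)) (by
      rintro x hx y hy hyx
      by_cases hyK : y ∈ K1
      · exact hq.not_prec_source hx hyK hyx
      have hy' : y ∈ K := hy.resolve_left hyK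
      have hyI : y ∉ I := fun h => hyK (hT1 ⟨h, hy'⟩)
      by_cases hxK : x ∈ K
      · exact ht.not_prec_source ⟨hI1 hx.1, hxK⟩ hy' hyx
      · exact R.prec_asymm hyx (hprec x (hI1 hx.1) hxK y hy' hyI)) (by
      rintro x hx y hy
      refine hr.not_target_prec hx ?_
      rw [← hu]
      exact hy.imp (fun h => hK1 h) id)
  refine ⟨u, (glues_iff hu').2 ⟨K1, K, hcut, ?_, ?_⟩, (glues_iff hr).2 ⟨I1, K1 ∪ K, ?_, ?_, ?_⟩⟩
  · rwa [hK1K]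
  · rwa [hK1K]
  · refine ⟨by rw [← Set.union_assoc, hu1, hu], hS1, fun x hx => Or.inr (hT hx), ?_⟩
    intro x hx hx' y hy hy'
    by_cases hyK : y ∈ K1
    · exact hprec1 x hx (fun h => hx' (Or.inl h)) y hyK hy'
    · have hyK' : y ∈ K := hy.resolve_left hyK
      exact hprec x (hI1 hx) (fun h => hx' (Or.inr h)) y hyK' fun h => hyK (hT1 ⟨h, hyK'⟩)
  · have : I1 ∩ (K1 ∪ K) = I1 ∩ K1 := by
      ext x
      exact ⟨fun h => ⟨h.1, h.2.elim id fun h' => hT1 ⟨hI1 h.1, h'⟩⟩, fun h => ⟨h.1, Or.inl h.2⟩⟩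
    rwa [this]
  · have : I1 ∩ (K1 ∪ K) = I1 ∩ K1 := by
      ext x
      exact ⟨fun h => ⟨h.1, h.2.elim id fun h' => hT1 ⟨hI1 h.1, h'⟩⟩, fun h => ⟨h.1, Or.inl h.2⟩⟩
    rwa [this]

theorem Glues.assoc_left {s q t u r : Ipomset A} (h1 : Glues q t u) (h2 : Glues s u r) :
    ∃ p, Glues s q p ∧ Glues p t r := by
  obtain ⟨n, R, rfl⟩ := r.exists_rep
  have hr := part_univ R
  obtain ⟨I, K, hc, hs, hu'⟩ := (glues_iff hr).1 h2
  obtain ⟨I1, K1, hc1, hq, ht⟩ := (glues_iff hu').1 h1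
  obtain ⟨hu, hS, hT, hprec⟩ := hc
  obtain ⟨hu1, hS1, hT1, hprec1⟩ := hc1
  have hI1 : I1 ⊆ K := hu1 ▸ Set.subset_union_left
  have hK1 : K1 ⊆ K := hu1 ▸ Set.subset_union_right
  have hII1 : I ∩ I1 = I ∩ K := by
    ext x
    exact ⟨fun h => ⟨h.1, hI1 h.2⟩, fun h => ⟨h.1, hS1 h⟩⟩
  have hcut : R.IsCut (I ∪ I1) R.source (I1 ∩ K1) I I1 := by
    refine ⟨rfl, hS, Set.inter_subset_left, fun x hx hxK y hy hyK => hprec x hx ?_ y (hI1 hy) hyK⟩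
    exact fun h => hxK (hS1 ⟨hx, h⟩)
  obtain ⟨p, hp⟩ := R.exists_part (I := I ∪ I1) (S := R.source) (T := I1 ∩ K1) (Set.toFinite _)
    (fun x hx => Or.inl (hS hx)) (fun x hx => Or.inr hx.1) (by
      rintro x hx y hy
      refine hr.not_prec_source hx ?_
      rw [← hu]
      exact hy.imp id fun h => hI1 h) (by
      rintro x hx y hy hxy
      by_cases hyI : y ∈ I1
      · exact hq.not_target_prec hx hyI hxy
      have hy' : y ∈ I := hy.resolve_right hyI
      have hyK : y ∉ K := fun h => hyI (hS1 ⟨hy', h⟩)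
      by_cases hxI : x ∈ I
      · exact hs.not_target_prec ⟨hxI, hI1 hx.1⟩ hy' hxy
      · exact R.prec_asymm hxy (hprec y hy' hyK x (hI1 hx.1) hxI))
  have hint : (I ∪ I1) ∩ K1 = I1 ∩ K1 := by
    ext x
    exact ⟨fun h => ⟨h.1.elim (fun h' => hS1 ⟨h', hK1 h.2⟩) id, h.2⟩, fun h => ⟨Or.inr h.1, h.2⟩⟩
  refine ⟨p, (glues_iff hp).2 ⟨I, I1, hcut, ?_, ?_⟩, (glues_iff hr).2 ⟨I ∪ I1, K1, ?_, ?_, ?_⟩⟩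
  · rwa [hII1]
  · rwa [hII1]
  · refine ⟨by rw [Set.union_assoc, hu1, hu], fun x hx => Or.inl (hS hx), hT1, ?_⟩
    intro x hx hx' y hy hy'
    by_cases hxI : x ∈ I1
    · exact hprec1 x hxI hx' y hy fun h => hy' (Or.inr h)
    · have hxI' : x ∈ I := hx.resolve_right hxI
      exact hprec x hxI' (fun h => hxI (hS1 ⟨hxI', h⟩)) y (hK1 hy) fun h => hy' (Or.inl h)
  · rwa [hint]
  · rwa [hint]

/-- A map out of a set covered by `α` and `β` may be defined on `α` and `β` separately. -/
theorem exists_map_of_cover {δ : Type*} {i : α → γ} {j : β → γ} {i' : α → δ} {j' : β → δ}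
    (hi : Function.Injective i) (hj : Function.Injective j)
    (hcov : ∀ u, (∃ x, i x = u) ∨ ∃ y, j y = u) (h : ∀ x y, i x = j y → i' x = j' y) :
    ∃ g : γ → δ, (∀ x, g (i x) = i' x) ∧ ∀ y, g (j y) = j' y := by
  have : ∀ u, ∃ v, (∀ x, i x = u → i' x = v) ∧ ∀ y, j y = u → j' y = v := by
    intro u
    rcases hcov u with ⟨x, rfl⟩ | ⟨y, rfl⟩
    · exact ⟨i' x, fun x' hx' => by rw [hi hx'], fun y hy => (h x y hy.symm).symm⟩
    · exact ⟨j' y, fun x hx => h x y hx, fun y' hy' => by rw [hj hy']⟩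
  choose g hg using this
  exact ⟨g, fun x => ((hg _).1 x rfl).symm, fun y => ((hg _).2 y rfl).symm⟩

theorem Glues.unique {p q r r' : Ipomset A} (h : Glues p q r) (h' : Glues p q r') : r = r' := by
  obtain ⟨n, R, rfl⟩ := r.exists_rep
  obtain ⟨n', R', rfl⟩ := r'.exists_rep
  obtain ⟨k, P, rfl⟩ := p.exists_rep
  obtain ⟨m, Q, rfl⟩ := q.exists_rep
  obtain ⟨I, K, hc, hp, hq⟩ := (glues_iff (part_univ R)).1 h
  obtain ⟨I', K', hc', hp', hq'⟩ := (glues_iff (part_univ R')).1 h'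
  obtain ⟨i, hi⟩ := hp.exists_isEmb
  obtain ⟨j, hj⟩ := hq.exists_isEmb
  obtain ⟨i', hi'⟩ := hp'.exists_isEmb
  obtain ⟨j', hj'⟩ := hq'.exists_isEmb
  obtain ⟨U, e, he, her⟩ := P.exists_isListing (Set.toFinite P.target)
    (fun x hx y _ => P.target_maximal x hx y)
  obtain ⟨V, l, hl, hlr⟩ := Q.exists_isListing (Set.toFinite Q.source)
    (fun x _ y hy => Q.source_minimal y hy x)
  have key : ∀ {n : ℕ} {R : Iposet A (Fin n)} {I K S T : Set (Fin n)} {i j},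
      IsEmb P R i I S (I ∩ K) → IsEmb Q R j K (I ∩ K) T →
      (⟨U, i ∘ e⟩ : (U : List A) × (Fin U.length → Fin n)) = ⟨V, j ∘ l⟩ := by
    intro n R I K S T i j hi hj
    refine (hi.isListing_comp.2 he).unique (hj.isListing_comp.2 hl) ?_
    rw [Set.range_comp, her, hi.target, Set.range_comp, hlr, hj.source]
  obtain rfl : U = V := (Sigma.mk.inj (key hi hj)).1
  have h1 : i ∘ e = j ∘ l := eq_of_heq (Sigma.mk.inj (key hi hj)).2
  have h2 : i' ∘ e = j' ∘ l := eq_of_heq (Sigma.mk.inj (key hi' hj')).2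
  have hover : ∀ {n : ℕ} {R : Iposet A (Fin n)} {I K S T : Set (Fin n)} {i j},
      IsEmb P R i I S (I ∩ K) → IsEmb Q R j K (I ∩ K) T → i ∘ e = j ∘ l →
      ∀ x y, i x = j y → ∃ a, x = e a ∧ y = l a := by
    intro n R I K S T i j hi hj hij x y hxy
    have : i x ∈ I ∩ K :=
      ⟨hi.range ▸ Set.mem_range_self x, by rw [hxy, ← hj.range]; exact Set.mem_range_self y⟩
    rw [← hi.target, ← her] at this
    obtain ⟨_, ⟨a, rfl⟩, ha⟩ := this
    refine ⟨a, (hi.inj ha).symm, hj.inj ?_⟩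
    rw [← hxy, ← ha]
    exact congrFun hij a
  have hcov : ∀ {n : ℕ} {R : Iposet A (Fin n)} {I K S T S' T' : Set (Fin n)} {i j},
      IsEmb P R i I S (I ∩ K) → IsEmb Q R j K (I ∩ K) T → R.IsCut Set.univ S' T' I K →
      ∀ u, (∃ x, i x = u) ∨ ∃ y, j y = u := by
    intro n R I K S T S' T' i j hi hj hc u
    have : u ∈ I ∪ K := by rw [hc.union]; trivial
    rwa [← hi.range, ← hj.range] at this
  obtain ⟨g, hgi, hgj⟩ := exists_map_of_cover (i' := i') (j' := j') hi.inj hj.inj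
    (hcov hi hj hc) (fun x y hxy => by
      obtain ⟨a, rfl, rfl⟩ := hover hi hj h1 x y hxy
      exact congrFun h2 a)
  obtain ⟨g', hgi', hgj'⟩ := exists_map_of_cover (i' := i) (j' := j) hi'.inj hj'.inj
    (hcov hi' hj' hc') (fun x y hxy => by
      obtain ⟨a, rfl, rfl⟩ := hover hi' hj' h2 x y hxy
      exact congrFun h1 a)
  have hg : ∀ u, g' (g u) = u := fun u => by
    rcases hcov hi hj hc u with ⟨x, rfl⟩ | ⟨y, rfl⟩
    · rw [hgi, hgi']
    · rw [hgj, hgj']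
  have hg' : ∀ u, g (g' u) = u := fun u => by
    rcases hcov hi' hj' hc' u with ⟨x, rfl⟩ | ⟨y, rfl⟩
    · rw [hgi', hgi]
    · rw [hgj', hgj]
  have hgI : ∀ u, u ∈ I ↔ g u ∈ I' := by
    have hsub : ∀ u, u ∈ I → g u ∈ I' := by
      rw [← hi.range, ← hi'.range]
      rintro _ ⟨x, rfl⟩
      exact ⟨x, (hgi x).symm⟩
    have hsub' : ∀ u, u ∈ I' → g' u ∈ I := by
      rw [← hi.range, ← hi'.range]
      rintro _ ⟨x, rfl⟩
      exact ⟨x, (hgi' x).symm⟩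
    exact fun u => ⟨hsub u, fun h => hg u ▸ hsub' _ h⟩
  have hgK : ∀ u, u ∈ K ↔ g u ∈ K' := by
    have hsub : ∀ u, u ∈ K → g u ∈ K' := by
      rw [← hj.range, ← hj'.range]
      rintro _ ⟨x, rfl⟩
      exact ⟨x, (hgj x).symm⟩
    have hsub' : ∀ u, u ∈ K' → g' u ∈ K := by
      rw [← hj.range, ← hj'.range]
      rintro _ ⟨x, rfl⟩
      exact ⟨x, (hgj' x).symm⟩
    exact fun u => ⟨hsub u, fun h => hg u ▸ hsub' _ h⟩
  have hIpair : ∀ u v, u ∈ I → v ∈ I → ((R.prec u v ↔ R'.prec (g u) (g v)) ∧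
      (R.Concurrent u v → (R.evord u v ↔ R'.evord (g u) (g v)))) := by
    rw [← hi.range]
    rintro _ _ ⟨x, rfl⟩ ⟨y, rfl⟩
    refine ⟨by rw [hgi, hgi, ← hi.prec, ← hi'.prec], fun hxy => ?_⟩
    have hxy' : P.Concurrent x y := by simpa [Concurrent, ← hi.prec] using hxy
    rw [hgi, hgi, ← hi.evord _ _ hxy', ← hi'.evord _ _ hxy']
  have hKpair : ∀ u v, u ∈ K → v ∈ K → ((R.prec u v ↔ R'.prec (g u) (g v)) ∧
      (R.Concurrent u v → (R.evord u v ↔ R'.evord (g u) (g v)))) := by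
    rw [← hj.range]
    rintro _ _ ⟨x, rfl⟩ ⟨y, rfl⟩
    refine ⟨by rw [hgj, hgj, ← hj.prec, ← hj'.prec], fun hxy => ?_⟩
    have hxy' : Q.Concurrent x y := by simpa [Concurrent, ← hj.prec] using hxy
    rw [hgj, hgj, ← hj.evord _ _ hxy', ← hj'.evord _ _ hxy']
  have hpair : ∀ u v, ((R.prec u v ↔ R'.prec (g u) (g v)) ∧
      (R.Concurrent u v → (R.evord u v ↔ R'.evord (g u) (g v)))) := by
    intro u v
    by_cases h1 : u ∈ I ∧ v ∈ I
    · exact hIpair u v h1.1 h1.2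
    by_cases h2 : u ∈ K ∧ v ∈ K
    · exact hKpair u v h2.1 h2.2
    have hu : u ∈ I ∪ K := by rw [hc.union]; trivial
    have hv : v ∈ I ∪ K := by rw [hc.union]; trivial
    rcases hu with hu | hu <;> rcases hv with hv | hv
    · exact absurd ⟨hu, hv⟩ h1
    · have huK : u ∉ K := fun h => h2 ⟨h, hv⟩
      have hvI : v ∉ I := fun h => h1 ⟨hu, h⟩
      have huv := hc.prec u hu huK v hv hvI
      have huv' := hc'.prec (g u) ((hgI u).1 hu) (mt (hgK u).2 huK) (g v) ((hgK v).1 hv)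
        (mt (hgI v).2 hvI)
      exact ⟨iff_of_true huv huv', fun h => absurd huv h.1⟩
    · have hvK : v ∉ K := fun h => h2 ⟨hu, h⟩
      have huI : u ∉ I := fun h => h1 ⟨h, hv⟩
      have huv := hc.prec v hv hvK u hu huI
      have huv' := hc'.prec (g v) ((hgI v).1 hv) (mt (hgK v).2 hvK) (g u) ((hgK u).1 hu)
        (mt (hgI u).2 huI)
      exact ⟨iff_of_false (R.prec_asymm huv) (R'.prec_asymm huv'), fun h => absurd huv h.2⟩
    · exact absurd ⟨hu, hv⟩ h2
  refine mk_eq_mk.2 ⟨⟨g, g', hg, hg'⟩, ?_, ?_, ?_, fun u v => (hpair u v).1,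
    fun u v => (hpair u v).2⟩
  · change g '' R.source = R'.source
    rw [← hi.source, ← hi'.source, ← Set.image_comp]
    exact Set.image_congr fun x _ => hgi x
  · change g '' R.target = R'.target
    rw [← hj.target, ← hj'.target, ← Set.image_comp]
    exact Set.image_congr fun x _ => hgj x
  · intro u
    change R'.label (g u) = R.label u
    rcases hcov hi hj hc u with ⟨x, rfl⟩ | ⟨y, rfl⟩
    · rw [hgi, hi.label, hi'.label]
    · rw [hgj, hj.label, hj'.label]

end Ipomset

namespace Iposet

variable {A α β γ : Type*}

/-! ### Existence of gluings -/

theorem transGen_or_cases {r s : γ → γ → Prop} {I K : Set γ}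
    (hr : ∀ x y z, r x y → r y z → r x z) (hs : ∀ x y z, s x y → s y z → s x z)
    (hrI : ∀ x y, r x y → x ∈ I ∧ y ∈ I) (hsK : ∀ x y, s x y → x ∈ K ∧ y ∈ K)
    (h : ∀ x y, x ∈ I ∩ K → y ∈ I ∩ K → (r x y ↔ s x y)) {u v : γ}
    (huv : Relation.TransGen (fun u v => r u v ∨ s u v) u v) :
    r u v ∨ s u v ∨ (∃ t, r u t ∧ s t v) ∨ ∃ t, s u t ∧ r t v := by
  induction huv using Relation.TransGen.head_induction_on with
  | single h => exact h.elim Or.inl fun h => Or.inr (Or.inl h)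
  | head h1 _ ih =>
    rename_i c _
    rcases h1 with h1 | h1
    · rcases ih with h2 | h2 | ⟨t, h2, h3⟩ | ⟨t, h2, h3⟩
      · exact Or.inl (hr _ _ _ h1 h2)
      · exact Or.inr (Or.inr (Or.inl ⟨c, h1, h2⟩))
      · exact Or.inr (Or.inr (Or.inl ⟨t, hr _ _ _ h1 h2, h3⟩))
      · have hc : c ∈ I ∩ K := ⟨(hrI _ _ h1).2, (hsK _ _ h2).1⟩
        have ht : t ∈ I ∩ K := ⟨(hrI _ _ h3).1, (hsK _ _ h2).2⟩
        exact Or.inl (hr _ _ _ h1 (hr _ _ _ ((h _ _ hc ht).2 h2) h3))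
    · rcases ih with h2 | h2 | ⟨t, h2, h3⟩ | ⟨t, h2, h3⟩
      · exact Or.inr (Or.inr (Or.inr ⟨c, h1, h2⟩))
      · exact Or.inr (Or.inl (hs _ _ _ h1 h2))
      · have hc : c ∈ I ∩ K := ⟨(hrI _ _ h2).1, (hsK _ _ h1).2⟩
        have ht : t ∈ I ∩ K := ⟨(hrI _ _ h2).2, (hsK _ _ h3).1⟩
        exact Or.inr (Or.inl (hs _ _ _ h1 (hs _ _ _ ((h _ _ hc ht).1 h2) h3)))
      · exact Or.inr (Or.inr (Or.inr ⟨t, hs _ _ _ h1 h2, h3⟩))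

/-- The union of two strict orders which agree on the common part of their domains generates a
strict order. -/
theorem transGen_or_irrefl {r s : γ → γ → Prop} {I K : Set γ}
    (hr : ∀ x y z, r x y → r y z → r x z) (hs : ∀ x y z, s x y → s y z → s x z)
    (hr' : ∀ x, ¬ r x x) (hs' : ∀ x, ¬ s x x)
    (hrI : ∀ x y, r x y → x ∈ I ∧ y ∈ I) (hsK : ∀ x y, s x y → x ∈ K ∧ y ∈ K)
    (h : ∀ x y, x ∈ I ∩ K → y ∈ I ∩ K → (r x y ↔ s x y)) (u : γ) :
    ¬ Relation.TransGen (fun u v => r u v ∨ s u v) u u := by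
  intro huu
  rcases transGen_or_cases hr hs hrI hsK h huu with h1 | h1 | ⟨t, h1, h2⟩ | ⟨t, h1, h2⟩
  · exact hr' _ h1
  · exact hs' _ h1
  · have hu : u ∈ I ∩ K := ⟨(hrI _ _ h1).1, (hsK _ _ h2).2⟩
    have ht : t ∈ I ∩ K := ⟨(hrI _ _ h1).2, (hsK _ _ h2).1⟩
    exact hs' _ (hs _ _ _ ((h _ _ hu ht).1 h1) h2)
  · have hu : u ∈ I ∩ K := ⟨(hrI _ _ h2).2, (hsK _ _ h1).1⟩
    have ht : t ∈ I ∩ K := ⟨(hrI _ _ h2).1, (hsK _ _ h1).2⟩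
    exact hr' _ (hr _ _ _ ((h _ _ hu ht).2 h1) h2)

/-- Interval representations on the two sides of a cut combine: the intervals on the right are
moved beyond those on the left, and events in both parts begin on the left and end on the right. -/
theorem exists_interval_of_cut [Finite γ] (I K : Set γ) (hIK : ∀ u, u ∈ I ∨ u ∈ K)
    (b₁ e₁ b₂ e₂ : γ → ℝ) (h₁ : ∀ u ∈ I, b₁ u ≤ e₁ u) (h₂ : ∀ u ∈ K, b₂ u ≤ e₂ u) :
    ∃ b e : γ → ℝ, (∀ u, b u ≤ e u) ∧
      (∀ u ∈ I, u ∉ K → ∀ v ∈ I, (e u < b v ↔ e₁ u < b₁ v)) ∧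
      (∀ u ∈ K, ∀ v ∈ K, v ∉ I → (e u < b v ↔ e₂ u < b₂ v)) ∧
      (∀ u ∈ I, u ∉ K → ∀ v ∈ K, v ∉ I → e u < b v) ∧
      ∀ u ∈ K, ∀ v ∈ I, ¬ e u < b v := by
  classical
  obtain ⟨c₁, hc₁⟩ := (Set.finite_range b₁).bddAbove
  obtain ⟨c₂, hc₂⟩ := (Set.finite_range e₁).bddAbove
  obtain ⟨d₁, hd₁⟩ := (Set.finite_range b₂).bddBelow
  obtain ⟨d₂, hd₂⟩ := (Set.finite_range e₂).bddBelow
  have hb₁ : ∀ u, b₁ u ≤ c₁ := fun u => hc₁ ⟨u, rfl⟩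
  have he₁ : ∀ u, e₁ u ≤ c₂ := fun u => hc₂ ⟨u, rfl⟩
  have hb₂ : ∀ u, d₁ ≤ b₂ u := fun u => hd₁ ⟨u, rfl⟩
  have he₂ : ∀ u, d₂ ≤ e₂ u := fun u => hd₂ ⟨u, rfl⟩
  obtain ⟨s, hs⟩ : ∃ s, max c₁ c₂ + 1 - min d₁ d₂ = s := ⟨_, rfl⟩
  have m1 := le_max_left c₁ c₂
  have m2 := le_max_right c₁ c₂
  have m3 := min_le_left d₁ d₂
  have m4 := min_le_right d₁ d₂
  refine ⟨fun u => if u ∈ I then b₁ u else b₂ u + s, fun u => if u ∈ K then e₂ u + s else e₁ u,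
    ?_, ?_, ?_, ?_, ?_⟩
  · intro u
    by_cases hI : u ∈ I <;> by_cases hK : u ∈ K <;> simp only [hI, hK, if_true, if_false]
    · linarith [hb₁ u, he₂ u]
    · exact h₁ u hI
    · linarith [h₂ u hK]
    · exact absurd (hIK u) (by simp [hI, hK])
  · intro u _ huK v hvI
    simp [huK, hvI]
  · intro u huK v _ hvI
    simp [huK, hvI]
  · intro u _ huK v _ hvI
    simp only [huK, hvI, if_false]
    linarith [he₁ u, hb₂ v]
  · intro u huK v hvI
    simp only [huK, hvI, if_true]
    linarith [he₂ u, hb₁ v]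

/-- The iposet without interfaces whose precedence order is that of the intervals `[b x, e x]`. -/
def ofInterval (b e : γ → ℝ) (hbe : ∀ x, b x ≤ e x) (E : γ → γ → Prop) (hE : ∀ x, ¬ E x x)
    (hE' : ∀ x y z, E x y → E y z → E x z)
    (h : ∀ x y, x ≠ y → e x < b y ∨ e y < b x ∨ E x y ∨ E y x) (label : γ → A) : Iposet A γ where
  prec x y := e x < b y
  evord := E
  source := ∅
  target := ∅
  label := label
  prec_irrefl x := not_lt.2 (hbe x)
  prec_trans _ y _ h1 h2 := h1.trans_le ((hbe y).trans h2.le)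
  evord_irrefl := hE
  evord_trans := hE'
  related := h
  interval := ⟨b, e, hbe, fun _ _ => Iff.rfl⟩
  source_minimal _ h := h.elim
  target_maximal _ h := h.elim

/-- The set-level pushout of two injections. -/
theorem exists_pushout {ι : Type*} [Finite α] [Finite β] {e : ι → α} {e' : ι → β}
    (he : Function.Injective e) (he' : Function.Injective e') :
    ∃ (n : ℕ) (i : α → Fin n) (j : β → Fin n), Function.Injective i ∧ Function.Injective j ∧
      (∀ u, (∃ x, i x = u) ∨ ∃ y, j y = u) ∧ ∀ x y, i x = j y ↔ ∃ a, x = e a ∧ y = e' a := by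
  classical
  let γ := α ⊕ {y : β // y ∉ Set.range e'}
  obtain ⟨n, ⟨φ⟩⟩ := Finite.exists_equiv_fin γ
  let j : β → γ := fun y =>
    if h : y ∈ Set.range e' then Sum.inl (e h.choose) else Sum.inr ⟨y, h⟩
  have hj : ∀ a, j (e' a) = Sum.inl (e a) := fun a => by
    have h : e' a ∈ Set.range e' := ⟨a, rfl⟩
    simp only [j, h, dif_pos]
    rw [he' h.choose_spec]
  have hj' : ∀ y (h : y ∉ Set.range e'), j y = Sum.inr ⟨y, h⟩ := fun y h => by
    simp only [j, h, dif_neg, not_false_eq_true]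
  refine ⟨n, φ ∘ Sum.inl, φ ∘ j, φ.injective.comp Sum.inl_injective, φ.injective.comp ?_, ?_, ?_⟩
  · intro y y' hyy
    by_cases h : y ∈ Set.range e' <;> by_cases h' : y' ∈ Set.range e'
    · obtain ⟨a, rfl⟩ := h
      obtain ⟨a', rfl⟩ := h'
      rw [hj, hj] at hyy
      rw [he (Sum.inl_injective hyy)]
    · obtain ⟨a, rfl⟩ := h
      rw [hj, hj' _ h'] at hyy
      cases hyy
    · obtain ⟨a, rfl⟩ := h'
      rw [hj, hj' _ h] at hyy
      cases hyy
    · rw [hj' _ h, hj' _ h'] at hyy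
      exact congrArg Subtype.val (Sum.inr_injective hyy)
  · intro u
    obtain ⟨u, rfl⟩ := φ.surjective u
    rcases u with x | ⟨y, hy⟩
    · exact Or.inl ⟨x, rfl⟩
    · exact Or.inr ⟨y, congrArg φ (hj' y hy)⟩
  · intro x y
    simp only [Function.comp_apply, φ.injective.eq_iff]
    constructor
    · intro hxy
      by_cases h : y ∈ Set.range e'
      · obtain ⟨a, rfl⟩ := h
        rw [hj] at hxy
        exact ⟨a, Sum.inl_injective hxy, rfl⟩
      · rw [hj' _ h] at hxy
        cases hxy
    · rintro ⟨a, rfl, rfl⟩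
      exact (hj a).symm

end Iposet

namespace Ipomset

variable {A α β γ : Type*}

/-- The gluing of `P` and `Q` exists if the target events of `P` and the source events of `Q` are
the same list. -/
theorem exists_glues {m n : ℕ} {P : Iposet A (Fin m)} {Q : Iposet A (Fin n)} {U : List A}
    {e : Fin U.length → Fin m} {e' : Fin U.length → Fin n} (he : P.IsListing U e)
    (her : Set.range e = P.target) (he' : Q.IsListing U e') (her' : Set.range e' = Q.source) :
    ∃ r, Glues (mk P) (mk Q) r := by
  obtain ⟨k, i, j, hi, hj, hcov, hij⟩ := exists_pushout he.injective he'.injective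
  obtain ⟨bP, eP, hP, hP'⟩ := P.interval
  obtain ⟨bQ, eQ, hQ, hQ'⟩ := Q.interval
  have hiK : ∀ x, i x ∈ Set.range j ↔ x ∈ P.target := by
    intro x
    rw [← her]
    constructor
    · rintro ⟨y, hy⟩
      obtain ⟨a, rfl, -⟩ := (hij x y).1 hy.symm
      exact ⟨a, rfl⟩
    · rintro ⟨a, rfl⟩
      exact ⟨e' a, ((hij _ _).2 ⟨a, rfl, rfl⟩).symm⟩
  have hjI : ∀ y, j y ∈ Set.range i ↔ y ∈ Q.source := by
    intro y
    rw [← her']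
    constructor
    · rintro ⟨x, hx⟩
      obtain ⟨a, -, rfl⟩ := (hij x y).1 hx
      exact ⟨a, rfl⟩
    · rintro ⟨a, rfl⟩
      exact ⟨e a, (hij _ _).2 ⟨a, rfl, rfl⟩⟩
  obtain ⟨b, f, hbf, h1, h2, h3, h4⟩ := exists_interval_of_cut (Set.range i) (Set.range j)
    hcov (Function.extend i bP 0) (Function.extend i eP 0)
    (Function.extend j bQ 0) (Function.extend j eQ 0)
    (by rintro _ ⟨x, rfl⟩; simpa [hi.extend_apply] using hP x)
    (by rintro _ ⟨x, rfl⟩; simpa [hj.extend_apply] using hQ x)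
  have hprecP : ∀ x y, P.prec x y ↔ f (i x) < b (i y) := by
    intro x y
    by_cases hx : x ∈ P.target
    · exact iff_of_false (P.target_maximal x hx y) (h4 _ ((hiK x).2 hx) _ ⟨y, rfl⟩)
    · rw [h1 _ ⟨x, rfl⟩ (mt (hiK x).1 hx) _ ⟨y, rfl⟩, hi.extend_apply, hi.extend_apply, hP']
  have hprecQ : ∀ x y, Q.prec x y ↔ f (j x) < b (j y) := by
    intro x y
    by_cases hy : y ∈ Q.source
    · exact iff_of_false (Q.source_minimal y hy x) (h4 _ ⟨x, rfl⟩ _ ((hjI y).2 hy))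
    · rw [h2 _ ⟨x, rfl⟩ _ ⟨y, rfl⟩ (mt (hjI y).1 hy), hj.extend_apply, hj.extend_apply, hQ']
  obtain ⟨lab, hlabP, hlabQ⟩ := exists_map_of_cover (i' := P.label) (j' := Q.label) hi hj hcov (by
    intro x y hxy
    obtain ⟨a, rfl, rfl⟩ := (hij x y).1 hxy
    rw [he.label, he'.label])
  let rP := Relation.Map P.evord i i
  let rQ := Relation.Map Q.evord j j
  have hrP : ∀ x y, rP (i x) (i y) ↔ P.evord x y := fun x y =>
    ⟨fun ⟨a, b, hab, ha, hb⟩ => by rwa [← hi ha, ← hi hb], fun h => ⟨x, y, h, rfl, rfl⟩⟩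
  have hrQ : ∀ x y, rQ (j x) (j y) ↔ Q.evord x y := fun x y =>
    ⟨fun ⟨a, b, hab, ha, hb⟩ => by rwa [← hj ha, ← hj hb], fun h => ⟨x, y, h, rfl, rfl⟩⟩
  have hE : ∀ u, ¬ Relation.TransGen (fun u v => rP u v ∨ rQ u v) u u := by
    refine transGen_or_irrefl (I := Set.range i) (K := Set.range j) ?_ ?_ ?_ ?_ ?_ ?_ ?_
    · rintro _ _ z ⟨x, y, hxy, rfl, rfl⟩ ⟨x', y', hxy', hx', rfl⟩
      exact ⟨x, y', P.evord_trans _ _ _ hxy (hi hx' ▸ hxy'), rfl, rfl⟩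
    · rintro _ _ z ⟨x, y, hxy, rfl, rfl⟩ ⟨x', y', hxy', hx', rfl⟩
      exact ⟨x, y', Q.evord_trans _ _ _ hxy (hj hx' ▸ hxy'), rfl, rfl⟩
    · rintro _ ⟨x, y, hxy, rfl, hy⟩
      exact P.evord_irrefl x (hi hy ▸ hxy)
    · rintro _ ⟨x, y, hxy, rfl, hy⟩
      exact Q.evord_irrefl x (hj hy ▸ hxy)
    · rintro _ _ ⟨x, y, hxy, rfl, rfl⟩
      exact ⟨⟨x, rfl⟩, y, rfl⟩
    · rintro _ _ ⟨x, y, hxy, rfl, rfl⟩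
      exact ⟨⟨x, rfl⟩, y, rfl⟩
    · rintro _ _ ⟨⟨x, rfl⟩, x', hx⟩ ⟨⟨y, rfl⟩, y', hy⟩
      obtain ⟨a, rfl, rfl⟩ := (hij x x').1 hx.symm
      obtain ⟨b, rfl, rfl⟩ := (hij y y').1 hy.symm
      rw [hrP, ← hx, ← hy, hrQ]
      rcases lt_trichotomy a b with hab | rfl | hab
      · exact iff_of_true (he.evord _ _ hab) (he'.evord _ _ hab)
      · exact iff_of_false (P.evord_irrefl _) (Q.evord_irrefl _)
      · exact iff_of_false (P.evord_asymm (he.evord _ _ hab)) (Q.evord_asymm (he'.evord _ _ hab))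
  have hrel : ∀ u v, u ≠ v → f u < b v ∨ f v < b u ∨
      Relation.TransGen (fun u v => rP u v ∨ rQ u v) u v ∨
      Relation.TransGen (fun u v => rP u v ∨ rQ u v) v u := by
    have hPP : ∀ x y, i x ≠ i y → f (i x) < b (i y) ∨ f (i y) < b (i x) ∨
      Relation.TransGen (fun u v => rP u v ∨ rQ u v) (i x) (i y) ∨
      Relation.TransGen (fun u v => rP u v ∨ rQ u v) (i y) (i x) := by
      intro x y hxy
      rw [← hprecP, ← hprecP]
      rcases P.related x y (fun h => hxy (congrArg i h)) with h | h | h | h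
      · exact Or.inl h
      · exact Or.inr (Or.inl h)
      · exact Or.inr (Or.inr (Or.inl (.single (Or.inl ((hrP x y).2 h)))))
      · exact Or.inr (Or.inr (Or.inr (.single (Or.inl ((hrP y x).2 h)))))
    have hQQ : ∀ x y, j x ≠ j y → f (j x) < b (j y) ∨ f (j y) < b (j x) ∨
      Relation.TransGen (fun u v => rP u v ∨ rQ u v) (j x) (j y) ∨
      Relation.TransGen (fun u v => rP u v ∨ rQ u v) (j y) (j x) := by
      intro x y hxy
      rw [← hprecQ, ← hprecQ]
      rcases Q.related x y (fun h => hxy (congrArg j h)) with h | h | h | h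
      · exact Or.inl h
      · exact Or.inr (Or.inl h)
      · exact Or.inr (Or.inr (Or.inl (.single (Or.inr ((hrQ x y).2 h)))))
      · exact Or.inr (Or.inr (Or.inr (.single (Or.inr ((hrQ y x).2 h)))))
    have hPQ : ∀ x y, i x ≠ j y → f (i x) < b (j y) ∨ f (j y) < b (i x) ∨
      Relation.TransGen (fun u v => rP u v ∨ rQ u v) (i x) (j y) ∨
      Relation.TransGen (fun u v => rP u v ∨ rQ u v) (j y) (i x) := by
      intro x y hxy
      by_cases hx : i x ∈ Set.range j
      · obtain ⟨y', hy'⟩ := hx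
        rw [← hy'] at hxy ⊢
        exact hQQ y' y hxy
      by_cases hy : j y ∈ Set.range i
      · obtain ⟨x', hx'⟩ := hy
        rw [← hx'] at hxy ⊢
        exact hPP x x' hxy
      exact Or.inl (h3 _ ⟨x, rfl⟩ hx _ ⟨y, rfl⟩ hy)
    intro u v huv
    rcases hcov u with ⟨x, rfl⟩ | ⟨x, rfl⟩ <;> rcases hcov v with ⟨y, rfl⟩ | ⟨y, rfl⟩
    · exact hPP x y huv
    · exact hPQ x y huv
    · rcases hPQ y x huv.symm with h | h | h | h <;> simp [h]
    · exact hQQ x y huv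
  let R : Iposet A (Fin k) :=
    ofInterval b f hbf _ hE (fun _ _ _ => Relation.TransGen.trans) hrel lab
  have hPR : IsEmb P R i (Set.range i) (i '' P.source) (Set.range i ∩ Set.range j) := by
    refine .of_evord_imp hi rfl rfl ?_ hlabP hprecP ?_
    · ext u
      constructor
      · rintro ⟨x, hx, rfl⟩
        exact ⟨⟨x, rfl⟩, (hiK x).2 hx⟩
      · rintro ⟨⟨x, rfl⟩, hx⟩
        exact ⟨x, (hiK x).1 hx, rfl⟩
    · exact fun x y _ hxy => .single (Or.inl ((hrP x y).2 hxy))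
  have hQR : IsEmb Q R j (Set.range j) (Set.range i ∩ Set.range j) (j '' Q.target) := by
    refine .of_evord_imp hj rfl ?_ rfl hlabQ hprecQ ?_
    · ext u
      constructor
      · rintro ⟨x, hx, rfl⟩
        exact ⟨(hjI x).2 hx, x, rfl⟩
      · rintro ⟨hx, x, rfl⟩
        exact ⟨x, (hjI x).1 hx, rfl⟩
    · exact fun x y _ hxy => .single (Or.inr ((hrQ x y).2 hxy))
  have hcut : R.IsCut Set.univ (i '' P.source) (j '' Q.target) (Set.range i) (Set.range j) :=
    ⟨by ext u; simpa using hcov u, Set.image_subset_range _ _, Set.image_subset_range _ _, h3⟩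
  obtain ⟨r, hr⟩ := R.exists_part (Set.toFinite Set.univ) (Set.subset_univ (i '' P.source))
    (Set.subset_univ (j '' Q.target)) (by
      rintro u hu v - hvu
      rcases hcov v with ⟨y, rfl⟩ | ⟨y, rfl⟩
      · exact hPR.part.not_prec_source hu ⟨y, rfl⟩ hvu
      · exact h4 _ ⟨y, rfl⟩ _ (hPR.source_subset hu) hvu) (by
      rintro u hu v - huv
      rcases hcov v with ⟨y, rfl⟩ | ⟨y, rfl⟩
      · exact h4 _ (hQR.target_subset hu) _ ⟨y, rfl⟩ huv
      · exact hQR.part.not_target_prec hu ⟨y, rfl⟩ huv)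
  exact ⟨r, (glues_iff hr).2 ⟨_, _, hcut, hPR.part, hQR.part⟩⟩

/-! ### Steps and identities -/

/-- The identity ipomset on the list `U`. -/
def idn (U : List A) : Ipomset A := mk (discrete U Set.univ Set.univ)

/-- The starter which begins the events of `U` that are not in `V`. -/
def starter {U V : List A} (f : SubLoset V U) : Ipomset A := mk (discrete U f.kept Set.univ)

/-- The terminator which ends the events of `U` that are not in `V`. -/
def terminator {U V : List A} (f : SubLoset V U) : Ipomset A := mk (discrete U Set.univ f.kept)

theorem glues_starter_iff {R : Iposet A γ} {J S T : Set γ} {p q : Ipomset A} {U V : List A}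
    {f : SubLoset V U} (hp : R.Part J S T p) :
    Glues (starter f) q p ↔
      ∃ e, R.IsListing U e ∧ e '' f.kept = S ∧ R.Part J (Set.range e) T q := by
  rw [glues_iff hp]
  constructor
  · rintro ⟨I, K, hc, h1, h2⟩
    obtain ⟨e, he, rfl, hS, hT⟩ := part_discrete_iff.1 h1
    rw [Set.image_univ] at hT
    have hK : K = J := by
      rw [← hc.union, Set.union_eq_right.2]
      rw [hT]
      exact Set.inter_subset_right
    rw [← hT, hK] at h2
    exact ⟨e, he, hS, h2⟩
  · rintro ⟨e, he, rfl, h⟩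
    have hJ : Set.range e ∩ J = Set.range e := Set.inter_eq_left.2 h.source_subset
    refine ⟨Set.range e, J, ⟨Set.union_eq_right.2 h.source_subset, Set.image_subset_range _ _,
      h.target_subset, fun x hx hx' => absurd (h.source_subset hx) hx'⟩, ?_, ?_⟩
    · rw [hJ]
      exact part_discrete_iff.2 ⟨e, he, rfl, rfl, Set.image_univ⟩
    · rwa [hJ]

theorem glues_terminator_iff {R : Iposet A γ} {J S T : Set γ} {p q : Ipomset A} {U V : List A}
    {f : SubLoset V U} (hp : R.Part J S T p) :
    Glues (terminator f) q p ↔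
      ∃ e, R.IsListing U e ∧ Set.range e = S ∧ R.Part (J \ e '' f.keptᶜ) (e '' f.kept) T q ∧
        ∀ x ∈ e '' f.keptᶜ, ∀ y ∈ J, y ∉ S → R.prec x y := by
  rw [glues_iff hp]
  constructor
  · rintro ⟨I, K, hc, h1, h2⟩
    obtain ⟨e, he, rfl, hS, hT⟩ := part_discrete_iff.1 h1
    rw [Set.image_univ] at hS
    subst hS
    have hK : K = J \ e '' f.keptᶜ := by
      rw [← hc.union]
      ext x
      constructor
      · refine fun hx => ⟨Or.inr hx, ?_⟩
        rintro ⟨i, hi, rfl⟩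
        have : e i ∈ e '' f.kept := hT ▸ ⟨⟨i, rfl⟩, hx⟩
        exact hi ((he.injective.mem_set_image).1 this)
      · rintro ⟨⟨i, rfl⟩ | hx, hx'⟩
        · have : e i ∈ e '' f.kept := ⟨i, by_contra fun h => hx' ⟨i, h, rfl⟩, rfl⟩
          rw [hT] at this
          exact this.2
        · exact hx
    rw [← hT] at h2
    refine ⟨e, he, rfl, hK ▸ h2, ?_⟩
    rintro _ ⟨i, hi, rfl⟩ y hy hyS
    have hiK : e i ∉ K := fun h => by
      rw [hK] at h
      exact h.2 ⟨i, hi, rfl⟩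
    rw [← hc.union] at hy
    exact hc.prec _ ⟨i, rfl⟩ hiK y (hy.resolve_left hyS) hyS
  · rintro ⟨e, he, rfl, h, hprec⟩
    have hJ : Set.range e ∩ (J \ e '' f.keptᶜ) = e '' f.kept := by
      ext x
      constructor
      · rintro ⟨⟨i, rfl⟩, -, hi⟩
        exact ⟨i, by_contra fun h => hi ⟨i, h, rfl⟩, rfl⟩
      · intro hx
        exact ⟨Set.image_subset_range _ _ hx, h.source_subset hx⟩
    refine ⟨Set.range e, J \ e '' f.keptᶜ, ⟨?_, subset_rfl, h.target_subset, ?_⟩, ?_, ?_⟩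
    · ext x
      constructor
      · rintro (hx | hx)
        · exact hp.source_subset hx
        · exact hx.1
      · intro hx
        by_cases h : x ∈ e '' f.keptᶜ
        · exact Or.inl (Set.image_subset_range _ _ h)
        · exact Or.inr ⟨hx, h⟩
    · rintro _ ⟨i, rfl⟩ hi y hy hye
      refine hprec _ ?_ y hy.1 hye
      by_contra hi'
      exact hi ⟨hp.source_subset ⟨i, rfl⟩, hi'⟩
    · rw [hJ]
      exact part_discrete_iff.2 ⟨e, he, rfl, Set.image_univ, rfl⟩
    · rwa [hJ]

theorem kept_refl (U : List A) : (SubLoset.refl U).kept = Set.univ :=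
  Set.range_eq_univ.2 fun x => ⟨x, rfl⟩

theorem starter_refl (U : List A) : starter (SubLoset.refl U) = idn U := by
  rw [starter, kept_refl, idn]

theorem Glues.eq_of_idn_left {U : List A} {q r : Ipomset A} (h : Glues (idn U) q r) : q = r := by
  obtain ⟨n, R, rfl⟩ := r.exists_rep
  rw [← starter_refl, glues_starter_iff (part_univ R)] at h
  obtain ⟨e, he, hS, hq⟩ := h
  rw [kept_refl, Set.image_univ] at hS
  exact (hS ▸ hq).unique (part_univ R)

theorem glues_idn_right {R : Iposet A γ} {J S : Set γ} {p : Ipomset A} {U : List A}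
    {e : Fin U.length → γ} (he : R.IsListing U e) (hp : R.Part J S (Set.range e) p) :
    Glues p (idn U) p := by
  have hJ : J ∩ Set.range e = Set.range e := Set.inter_eq_right.2 hp.target_subset
  refine (glues_iff hp).2 ⟨J, Set.range e, ⟨Set.union_eq_left.2 hp.target_subset,
    hp.source_subset, subset_rfl, fun x _ _ y hy hy' => absurd (hp.target_subset hy) hy'⟩, ?_, ?_⟩
  · rwa [hJ]
  · rw [hJ]
    exact part_discrete_iff.2 ⟨e, he, rfl, Set.image_univ, Set.image_univ⟩

/-- Gluing a starter to the left shrinks the source interface. -/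
theorem Glues.part_of_starter {R : Iposet A γ} {K S T : Set γ} {q t : Ipomset A} {U V : List A}
    {f : SubLoset V U} (h : Glues (starter f) q t) (hq : R.Part K S T q) :
    ∃ e, R.IsListing U e ∧ Set.range e = S ∧ R.Part K (e '' f.kept) T t := by
  obtain ⟨n, T', rfl⟩ := t.exists_rep
  obtain ⟨l, hl, hlS, hq'⟩ := (glues_starter_iff (part_univ T')).1 h
  obtain ⟨m, Q, rfl⟩ := q.exists_rep
  obtain ⟨g, hg⟩ := hq'.exists_isEmb
  obtain ⟨φ, hφ⟩ := hq.exists_isEmb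
  obtain ⟨l', rfl⟩ := hg.exists_lift_range (l := l) (Set.subset_univ _)
  have hl' := hg.isListing_comp.1 hl
  have hsrc : Set.range l' = Q.source := by
    have := hg.source
    rw [Set.range_comp] at this
    exact ((Set.image_injective.2 hg.inj) this).symm
  refine ⟨φ ∘ l', hφ.isListing_comp.2 hl', by rw [Set.range_comp, hsrc, hφ.source], ?_⟩
  have := hφ.part_image (hg.part_preimage (Set.subset_univ _) (part_univ T'))
  rw [← hlS, Set.preimage_univ, Set.image_univ, hφ.range, Set.image_comp,
    hg.inj.preimage_image, ← Set.image_comp] at this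
  convert this using 1
  rw [← hg.target, hg.inj.preimage_image, hφ.target]

end Ipomset

/-! ### Rows and columns of a relation -/

theorem Set.Finite.range_columns {α β : Type*} {B : α → β → Prop}
    (h : (Set.range fun a => {b | B a b}).Finite) : (Set.range fun b => {a | B a b}).Finite := by
  refine (h.powerset.image fun 𝒮 => {a | {b | B a b} ∈ 𝒮}).subset ?_
  rintro _ ⟨b, rfl⟩
  refine ⟨{M ∈ Set.range fun a => {b | B a b} | b ∈ M}, fun M hM => hM.1, ?_⟩
  ext a
  exact ⟨fun h => h.2, fun h => ⟨⟨a, rfl⟩, h⟩⟩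

namespace Ipomset

/-- Prefix quotients are the rows, and suffix quotients the columns, of the relation between `p`
and `q` which says that `p * q` is defined and in `L`. -/
theorem finite_prefixQuotients_iff {A : Type*} (L : Set (Ipomset A)) :
    (prefixQuotients L).Finite ↔ (suffixQuotients L).Finite := by
  have h1 : prefixQuotients L = Set.range fun p => {q | ∃ r ∈ L, Glues p q r} := by
    ext M; exact exists_congr fun p => eq_comm
  have h2 : suffixQuotients L = Set.range fun q => {p | ∃ r ∈ L, Glues p q r} := by
    ext M; exact exists_congr fun p => eq_comm
  rw [h1, h2]
  exact ⟨Set.Finite.range_columns, Set.Finite.range_columns⟩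

end Ipomset

theorem SubLoset.eq_of_kept_eq_univ {A : Type*} {U V : List A} {f : SubLoset V U}
    (h : f.kept = Set.univ) : V = U := by
  have hU := discrete_isListing U ∅ ∅
  have := (hU.comp_subLoset f).unique hU (by
    rw [range_comp_incl, h, Set.image_univ])
  exact (Sigma.mk.inj this).1

open Ipomset

namespace HDA

variable {A γ : Type*} {X : HDA A}

/-! ### Paths of a higher-dimensional automaton -/

theorem Path.exists_isListing {x z : X.Cell} (α : X.Path x z) {R : Iposet A γ} {J S T : Set γ}
    {p : Ipomset A} (hp : R.Part J S T p) (h : α.HasEvent p) :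
    (∃ e, R.IsListing x.1 e ∧ Set.range e = S) ∧ ∃ e, R.IsListing z.1 e ∧ Set.range e = T := by
  induction α generalizing J S p with
  | nil x =>
    obtain rfl := h
    obtain ⟨e, he, -, hS, hT⟩ := part_discrete_iff.1 hp
    rw [Set.image_univ] at hS hT
    exact ⟨⟨e, he, hS⟩, e, he, hT⟩
  | cons s α ih =>
    obtain ⟨q, hq, hg⟩ := h
    cases s with
    | up f x' =>
      obtain ⟨e, he, hS, hq'⟩ := (glues_starter_iff hp).1 hg
      exact ⟨⟨e ∘ f.incl, he.comp_subLoset f, by rw [range_comp_incl, hS]⟩, (ih hq' hq).2⟩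
    | down f x' =>
      obtain ⟨e, he, hS, hq', -⟩ := (glues_terminator_iff hp).1 hg
      exact ⟨⟨e, he, hS⟩, (ih hq' hq).2⟩

/-- Concatenation of paths. -/
def Path.append {x y : X.Cell} : X.Path x y → ∀ {z : X.Cell}, X.Path y z → X.Path x z
  | .nil _, _, β => β
  | .cons s α, _, β => .cons s (α.append β)

theorem Path.hasEvent_append {x y z : X.Cell} (α : X.Path x y) (β : X.Path y z)
    {p q r : Ipomset A} (hα : α.HasEvent p) (hβ : β.HasEvent q) (h : Glues p q r) :
    (α.append β).HasEvent r := by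
  induction α generalizing p r with
  | nil x =>
    obtain rfl := hα
    exact h.eq_of_idn_left ▸ hβ
  | cons s α ih =>
    obtain ⟨p', hp', hs⟩ := hα
    obtain ⟨u, hu, hu'⟩ := hs.assoc_right h
    exact ⟨u, ih β hp' hβ hu, hu'⟩

theorem Path.exists_glues {x y z : X.Cell} (α : X.Path x y) (β : X.Path y z)
    {p q : Ipomset A} (hα : α.HasEvent p) (hβ : β.HasEvent q) : ∃ r, Glues p q r := by
  obtain ⟨m, P, rfl⟩ := p.exists_rep
  obtain ⟨n, Q, rfl⟩ := q.exists_rep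
  obtain ⟨e, he, her⟩ := (α.exists_isListing (part_univ P) hα).2
  obtain ⟨e', he', her'⟩ := (β.exists_isListing (part_univ Q) hβ).1
  exact Ipomset.exists_glues he her he' her'

/-- A path which terminates no event is equivalent to a single upstep. -/
theorem Path.eq_face_zero {x z : X.Cell} (α : X.Path x z) {R : Iposet A γ} {J S : Set γ}
    {p : Ipomset A} (hp : R.Part J S J p) (h : α.HasEvent p) :
    ∃ e, R.IsListing z.1 e ∧ Set.range e = J ∧
      ∃ g : SubLoset x.1 z.1, e '' g.kept = S ∧ x.2 = X.face 0 g z.2 := by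
  induction α generalizing S p with
  | nil x =>
    obtain rfl := h
    obtain ⟨e, he, hJ, hS, -⟩ := part_discrete_iff.1 hp
    exact ⟨e, he, hJ, SubLoset.refl _,
      (congrArg (e '' ·) (kept_refl _)).trans hS, (X.face_refl _ _ _).symm⟩
  | cons s α ih =>
    obtain ⟨q, hq, hg⟩ := h
    cases s with
    | up f x' =>
      obtain ⟨e₀, he₀, hS, hq'⟩ := (glues_starter_iff hp).1 hg
      obtain ⟨e, he, hJ, g, hgS, hx'⟩ := ih hq' hq
      have heg : e ∘ g.incl = e₀ := eq_of_heq (Sigma.mk.inj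
        ((he.comp_subLoset g).unique he₀ (by rw [range_comp_incl, hgS]))).2
      refine ⟨e, he, hJ, f.trans g, ?_, ?_⟩
      · rw [← hS, ← range_comp_incl, ← heg, ← range_comp_incl]; rfl
      · dsimp only at hx'
        rw [hx', X.face_trans]
    | down f x' =>
      obtain ⟨e₀, he₀, hS, hq', -⟩ := (glues_terminator_iff hp).1 hg
      have hkept : f.kept = Set.univ := by
        refine Set.eq_univ_of_forall fun i => by_contra fun hi => ?_
        exact (hq'.target_subset (hp.source_subset (hS ▸ ⟨i, rfl⟩))).2 ⟨i, hi, rfl⟩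
      obtain rfl := SubLoset.eq_of_kept_eq_univ hkept
      obtain rfl : f = SubLoset.refl _ := SubLoset.ext_of_kept (by rw [hkept, kept_refl])
      rw [hkept, Set.compl_univ, Set.image_empty, Set.sdiff_empty, Set.image_univ, hS] at hq'
      obtain ⟨e, he, hJ, g, hgS, hx'⟩ := ih hq' hq
      dsimp only at hx'
      exact ⟨e, he, hJ, g, hgS, by rwa [X.face_refl] at hx'⟩

/-- A path which starts no event is equivalent to a single downstep. -/
theorem Path.eq_face_one {x z : X.Cell} (α : X.Path x z) {R : Iposet A γ} {J T : Set γ}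
    {p : Ipomset A} (hp : R.Part J J T p) (h : α.HasEvent p) {e : Fin x.1.length → γ}
    (he : R.IsListing x.1 e) (her : Set.range e = J) :
    ∃ g : SubLoset z.1 x.1, e '' g.kept = T ∧ z.2 = X.face 1 g x.2 := by
  induction α generalizing J p with
  | nil x =>
    obtain rfl := h
    obtain ⟨e₀, he₀, hJ, -, hT⟩ := part_discrete_iff.1 hp
    refine ⟨SubLoset.refl _, ?_, (X.face_refl _ _ _).symm⟩
    rw [kept_refl, Set.image_univ, her, ← hJ, ← hT, Set.image_univ]
  | cons s α ih =>
    obtain ⟨q, hq, hg⟩ := h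
    cases s with
    | up f x' =>
      obtain ⟨e₀, he₀, hS, hq'⟩ := (glues_starter_iff hp).1 hg
      have hkept : f.kept = Set.univ := by
        refine Set.eq_univ_of_forall fun i => ?_
        have : e₀ i ∈ J := hq'.source_subset ⟨i, rfl⟩
        rw [← hS] at this
        exact (he₀.injective.mem_set_image).1 this
      obtain rfl := SubLoset.eq_of_kept_eq_univ hkept
      obtain rfl : f = SubLoset.refl _ := SubLoset.ext_of_kept (by rw [hkept, kept_refl])
      rw [hkept, Set.image_univ] at hS
      obtain ⟨g, hgT, hz⟩ := ih (hS ▸ hq') hq he her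
      refine ⟨g, hgT, ?_⟩
      dsimp only
      rw [X.face_refl]
      exact hz
    | down f x' =>
      obtain ⟨e₀, he₀, hS, hq', -⟩ := (glues_terminator_iff hp).1 hg
      obtain rfl : e = e₀ := eq_of_heq (Sigma.mk.inj (he.unique he₀ (by rw [her, hS]))).2
      have hJ : J \ e '' f.keptᶜ = e '' f.kept := by
        rw [← her, Set.image_compl_eq_range_sdiff_image he.injective,
          Set.sdiff_sdiff_cancel_left (Set.image_subset_range _ _)]
      rw [hJ] at hq'
      obtain ⟨g, hgT, hz⟩ := ih hq' hq (he.comp_subLoset f) (range_comp_incl e f)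
      refine ⟨g.trans f, ?_, ?_⟩
      · rw [← hgT, ← range_comp_incl, ← range_comp_incl]; rfl
      · rw [hz, X.face_trans]

/-- A path whose event ipomset is `p * q` can be replaced by a path with event ipomset `p`
followed by one with event ipomset `q`. -/
theorem Path.exists_factorization [Finite γ] {x y : X.Cell} (α : X.Path x y) {R : Iposet A γ}
    {J S T I K : Set γ} {r p q : Ipomset A} (hr : R.Part J S T r) (h : α.HasEvent r)
    (hc : R.IsCut J S T I K) (hp : R.Part I S (I ∩ K) p) (hq : R.Part K (I ∩ K) T q) :
    ∃ (z : X.Cell) (α₁ : X.Path x z) (α₂ : X.Path z y), α₁.HasEvent p ∧ α₂.HasEvent q := by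
  induction α generalizing J S I K r p q with
  | nil x =>
    obtain rfl := h
    obtain ⟨e, he, hJ, hS, hT⟩ := part_discrete_iff.1 hr
    rw [Set.image_univ] at hS hT
    subst hS
    subst hT
    subst hJ
    have hI : I = Set.range e := (hc.union ▸ Set.subset_union_left).antisymm hc.source
    have hK : K = Set.range e := (hc.union ▸ Set.subset_union_right).antisymm hc.target
    subst hI
    subst hK
    rw [Set.inter_self] at hp hq
    exact ⟨x, .nil x, .nil x, hp.unique hr, hq.unique hr⟩
  | cons s α ih =>
    obtain ⟨q₀, hq₀, hg⟩ := h
    have hIJ : I ⊆ J := hc.union ▸ Set.subset_union_left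
    have hKJ : K ⊆ J := hc.union ▸ Set.subset_union_right
    cases s with
    | @up U V f x' =>
      obtain ⟨e, he, hS, hr'⟩ := (glues_starter_iff hr).1 hg
      by_cases heI : Set.range e ⊆ I
      · obtain ⟨p', hp'⟩ := R.exists_part (Set.toFinite I) heI
          (Set.inter_subset_left : I ∩ K ⊆ I)
          (fun a ha b hb => hr'.not_prec_source ha (hIJ hb))
          (fun a ha b hb => hp.not_target_prec ha hb)
        obtain ⟨z, α₁, α₂, h1, h2⟩ := ih hr' hq₀ ⟨hc.union, heI, hc.target, hc.prec⟩ hp' hq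
        exact ⟨z, .cons (.up f x') α₁, α₂,
          ⟨p', h1, (glues_starter_iff hp).2 ⟨e, he, hS, hp'⟩⟩, h2⟩
      · -- An event in `I \ K` would precede the events outside `I` which are started by this
        -- step, but these are minimal.
        have hIK : I ⊆ K := by
          intro a ha
          by_contra haK
          obtain ⟨b, hb, hbI⟩ := Set.not_subset.1 heI
          have hbJ := hr'.source_subset hb
          rw [← hc.union] at hbJ
          exact hr'.not_prec_source hb (hIJ ha) (hc.prec a ha haK b (hbJ.resolve_left hbI) hbI)
        obtain rfl : K = J := by rw [← hc.union, Set.union_eq_right.2 hIK]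
        rw [Set.inter_eq_left.2 hIK] at hp hq
        have hmin : ∀ a ∈ I ∪ Set.range e, ∀ b ∈ K, ¬ R.prec b a := by
          rintro a (ha | ha) b hb
          · exact hq.not_prec_source ha hb
          · exact hr'.not_prec_source ha hb
        have hDK : I ∪ Set.range e ⊆ K := Set.union_subset hIK hr'.source_subset
        obtain ⟨p', hp'⟩ := R.exists_part (I := I ∪ Set.range e) (S := Set.range e)
          (T := I ∪ Set.range e) (Set.toFinite _) Set.subset_union_right subset_rfl
          (fun a ha b hb => hmin a (Or.inr ha) b (hDK hb))
          (fun a ha b hb => hmin b hb a (hDK ha))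
        obtain ⟨q', hq'⟩ := R.exists_part (I := K) (S := I ∪ Set.range e) (T := T)
          (Set.toFinite _) hDK hr.target_subset hmin
          (fun a ha b hb => hr.not_target_prec ha hb)
        have hint : (I ∪ Set.range e) ∩ K = I ∪ Set.range e := Set.inter_eq_left.2 hDK
        obtain ⟨z, α₁, α₂, h1, h2⟩ := ih hr' hq₀
          (I := I ∪ Set.range e) (K := K) ⟨Set.union_eq_right.2 hDK, Set.subset_union_right,
            hr.target_subset, fun a ha ha' => absurd (hDK ha) ha'⟩ (by rw [hint]; exact hp')
            (by rw [hint]; exact hq')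
        obtain ⟨W, w⟩ := z
        obtain ⟨l, hl, hlr, g, hgS, hx'⟩ := α₁.eq_face_zero hp' h1
        dsimp only at l hl hlr g hgS hx'
        have hlg : l ∘ g.incl = e := eq_of_heq (Sigma.mk.inj
          ((hl.comp_subLoset g).unique he (by rw [range_comp_incl, hgS]))).2
        obtain ⟨V', k, hk⟩ := hl.exists_restrict (I := I) (hlr ▸ Set.subset_union_left)
        obtain ⟨m, hm⟩ := (hl.comp_subLoset k).exists_subLoset (he.comp_subLoset f) (by
          rw [range_comp_incl, range_comp_incl, hS, hk]
          exact hp.source_subset)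
        have hmk : m.trans k = f.trans g := by
          refine SubLoset.ext_of_comp hl.injective ?_
          calc l ∘ (m.trans k).incl = (l ∘ k.incl) ∘ m.incl := rfl
            _ = e ∘ f.incl := hm.symm
            _ = l ∘ (f.trans g).incl := by rw [← hlg]; rfl
        have hface : X.face 0 f x' = X.face 0 m (X.face 0 k w) := by
          rw [hx', X.face_trans, X.face_trans, hmk]
        have hkS : (l ∘ k.incl) '' m.kept = S := by
          rw [← range_comp_incl, ← hm, range_comp_incl, hS]
        rw [hface]
        refine ⟨⟨V', X.face 0 k w⟩, .cons (.up m (X.face 0 k w)) (.nil _),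
          .cons (.up k w) α₂, ⟨idn V', rfl, (glues_starter_iff hp).2
            ⟨l ∘ k.incl, hl.comp_subLoset k, hkS, ?_⟩⟩,
          q', h2, (glues_starter_iff hq).2 ⟨l, hl, hk, hlr ▸ hq'⟩⟩
        rw [range_comp_incl, hk]
        exact part_discrete_iff.2 ⟨l ∘ k.incl, hl.comp_subLoset k, by rw [range_comp_incl, hk],
          by rw [Set.image_univ, range_comp_incl, hk], by rw [Set.image_univ, range_comp_incl, hk]⟩
    | @down U V f x' =>
      obtain ⟨e, he, rfl, hr', hprec⟩ := (glues_terminator_iff hr).1 hg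
      obtain ⟨B, hB⟩ : ∃ B, e '' f.keptᶜ = B := ⟨_, rfl⟩
      rw [hB] at hr' hprec
      have hBe : B ⊆ Set.range e := hB ▸ Set.image_subset_range _ _
      have hkB : e '' f.kept = Set.range e \ B := by
        rw [← hB, Set.image_compl_eq_range_sdiff_image he.injective,
          Set.sdiff_sdiff_cancel_left (Set.image_subset_range _ _)]
      by_cases hBK : ∃ b ∈ B, b ∈ K
      · obtain ⟨b, hb, hbK⟩ := hBK
        -- The event `b` precedes all events outside `range e`, but is maximal in `I`.
        have hI : Set.range e = I := by
          refine hc.source.antisymm fun a ha => by_contra fun hae => ?_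
          exact hp.not_target_prec ⟨hc.source (hBe hb), hbK⟩ ha (hprec b hb a (hIJ ha) hae)
        rw [hI] at hBe hkB hprec
        have hD : (I \ B) ∩ (K \ B) = (I ∩ K) \ B := by
          ext a; exact ⟨fun h => ⟨⟨h.1.1, h.2.1⟩, h.1.2⟩, fun h => ⟨⟨h.1.1, h.2⟩, h.1.2, h.2⟩⟩
        have hanti : ∀ a ∈ I, ∀ b ∈ I, ¬ R.prec a b := by
          rw [← hI]
          rintro _ ⟨i, rfl⟩ _ ⟨j, rfl⟩
          exact he.conc i j
        obtain ⟨p', hp'⟩ := R.exists_part (I := I \ B) (S := I \ B) (T := (I ∩ K) \ B)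
          (Set.toFinite _) subset_rfl (Set.sdiff_subset_sdiff_left Set.inter_subset_left)
          (fun a ha b hb => hanti b hb.1 a ha.1) (fun a ha b hb => hanti a ha.1.1 b hb.1)
        obtain ⟨q', hq'⟩ := R.exists_part (I := K \ B) (S := (I ∩ K) \ B) (T := T)
          (Set.toFinite _) (Set.sdiff_subset_sdiff_left Set.inter_subset_right)
          (fun a ha => ⟨hc.target ha, (hr'.target_subset ha).2⟩)
          (fun a ha b hb => hq.not_prec_source ha.1 hb.1)
          (fun a ha b hb => hq.not_target_prec ha hb.1)
        obtain ⟨z, α₁, α₂, h1, h2⟩ := ih hr' hq₀ (I := I \ B) (K := K \ B)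
          ⟨by rw [← hc.union, Set.union_sdiff_distrib], by rw [hkB],
            fun a ha => ⟨hc.target ha, (hr'.target_subset ha).2⟩,
            fun a ha haK b hb hbI => hc.prec a ha.1 (fun h => haK ⟨h, ha.2⟩) b hb.1
              (fun h => hbI ⟨h, hb.2⟩)⟩ (by rw [hkB, hD]; exact hp') (by rw [hD]; exact hq')
        obtain ⟨W, w⟩ := z
        obtain ⟨g, hgT, hw⟩ := α₁.eq_face_one hp' h1 (he.comp_subLoset f)
          (by rw [range_comp_incl, hkB])
        dsimp only at g hgT hw
        obtain ⟨V', k, hk⟩ := he.exists_restrict (I := I ∩ K) (hI ▸ Set.inter_subset_left)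
        obtain ⟨m, hm⟩ := (he.comp_subLoset k).exists_subLoset
          ((he.comp_subLoset f).comp_subLoset g) (by
          rw [range_comp_incl, range_comp_incl, hgT, hk]
          exact Set.sdiff_subset)
        have hmk : m.trans k = g.trans f := by
          refine SubLoset.ext_of_comp he.injective ?_
          calc e ∘ (m.trans k).incl = (e ∘ k.incl) ∘ m.incl := rfl
            _ = (e ∘ f.incl) ∘ g.incl := hm.symm
        have hface : X.face 1 m (X.face 1 k x') = w := by
          rw [hw, X.face_trans, X.face_trans, hmk]
        subst hface
        have hcompl : Set.range e \ e '' k.keptᶜ = I ∩ K := by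
          rw [Set.image_compl_eq_range_sdiff_image he.injective,
            Set.sdiff_sdiff_cancel_left (Set.image_subset_range _ _), hk]
        have hmD : (e ∘ k.incl) '' m.kept = (I ∩ K) \ B := by
          rw [← range_comp_incl, ← hm, range_comp_incl, hgT]
        have hmB : (e ∘ k.incl) '' m.keptᶜ = K ∩ B := by
          rw [Set.image_compl_eq_range_sdiff_image (he.comp_subLoset k).injective,
            range_comp_incl, hk, hmD]
          ext a
          constructor
          · exact fun h => ⟨h.1.2, by_contra fun h' => h.2 ⟨h.1, h'⟩⟩
          · exact fun h => ⟨⟨hBe h.2, h.1⟩, fun h' => h'.2 h.2⟩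
        refine ⟨⟨V', X.face 1 k x'⟩, .cons (.down k x') (.nil _),
          .cons (.down m (X.face 1 k x')) α₂, ⟨idn V', rfl, (glues_terminator_iff hp).2
            ⟨e, he, rfl, ?_, fun a _ b hb hb' => absurd (hI ▸ hb) hb'⟩⟩,
          q', h2, (glues_terminator_iff hq).2 ⟨e ∘ k.incl, he.comp_subLoset k,
            by rw [range_comp_incl, hk], ?_, ?_⟩⟩
        · rw [← hI, hcompl, hk, hI]
          exact part_discrete_iff.2 ⟨e ∘ k.incl, he.comp_subLoset k, by rw [range_comp_incl, hk],
            by rw [Set.image_univ, range_comp_incl, hk],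
            by rw [Set.image_univ, range_comp_incl, hk]⟩
        · rw [hmD, hmB, Set.sdiff_self_inter]
          exact hq'
        · rw [hmB]
          exact fun a ha b hb hb' => hprec a ha.2 b (hKJ hb) fun h => hb' ⟨h, hb⟩
      · have hBK' : ∀ a ∈ K, a ∉ B := fun a ha ha' => hBK ⟨a, ha', ha⟩
        have hint : (I \ B) ∩ K = I ∩ K := by
          ext a; exact ⟨fun h => ⟨h.1.1, h.2⟩, fun h => ⟨⟨h.1, hBK' a h.2⟩, h.2⟩⟩
        have hsrc : e '' f.kept ⊆ I \ B := by
          rw [hkB]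
          exact Set.sdiff_subset_sdiff_left hc.source
        obtain ⟨p', hp'⟩ := R.exists_part (I := I \ B) (S := e '' f.kept) (T := I ∩ K)
          (Set.toFinite _) hsrc (hint ▸ Set.inter_subset_left)
          (fun a ha b hb => hr'.not_prec_source ha ⟨hIJ hb.1, hb.2⟩)
          (fun a ha b hb => hp.not_target_prec ha hb.1)
        obtain ⟨z, α₁, α₂, h1, h2⟩ := ih hr' hq₀ (I := I \ B) (K := K)
          ⟨by rw [← hc.union, Set.union_sdiff_distrib, sdiff_eq_left.2
              (Set.disjoint_left.2 hBK' : Disjoint K B)], hsrc, hc.target,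
            fun a ha haK b hb hbI => hc.prec a ha.1 haK b hb fun h => hbI ⟨h, hBK' b hb⟩⟩
          (hint.symm ▸ hp') (hint.symm ▸ hq)
        exact ⟨z, .cons (.down f x') α₁, α₂, ⟨p', h1, (glues_terminator_iff hp).2
          ⟨e, he, rfl, hB ▸ hp', hB ▸ fun a ha b hb hb' => hprec a ha b (hIJ hb) hb'⟩⟩, h2⟩

/-- The prefix quotient of the language of an automaton by `p` depends only on the set of cells
which are reached from start cells by paths with event ipomset `p`. -/
theorem prefixQuotient_language (X : HDA A) (p : Ipomset A) :
    prefixQuotient p X.language =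
      {q | ∃ z ∈ {z | ∃ x ∈ X.start, ∃ α : X.Path x z, α.HasEvent p},
        ∃ y ∈ X.accept, ∃ β : X.Path z y, β.HasEvent q} := by
  ext q
  constructor
  · rintro ⟨r, ⟨x, hx, y, hy, α, hα⟩, h⟩
    obtain ⟨n, R, rfl⟩ := r.exists_rep
    obtain ⟨I, K, hc, hp, hq⟩ := (glues_iff (part_univ R)).1 h
    obtain ⟨z, α₁, α₂, h1, h2⟩ := α.exists_factorization (part_univ R) hα hc hp hq
    exact ⟨z, ⟨x, hx, α₁, h1⟩, y, hy, α₂, h2⟩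
  · rintro ⟨z, ⟨x, hx, α, hα⟩, y, hy, β, hβ⟩
    obtain ⟨r, hr⟩ := α.exists_glues β hα hβ
    exact ⟨r, ⟨x, hx, y, hy, α.append β, α.hasEvent_append β hα hβ hr⟩, hr⟩

theorem finite_prefixQuotients_language (X : HDA A) [Finite X.Cell] :
    (prefixQuotients X.language).Finite := by
  refine (Set.finite_range fun Z : Set X.Cell =>
    {q | ∃ z ∈ Z, ∃ y ∈ X.accept, ∃ β : X.Path z y, β.HasEvent q}).subset ?_
  rintro _ ⟨p, rfl⟩
  exact ⟨_, (X.prefixQuotient_language p).symm⟩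

end HDA

/-! ### Quotient data of iposets -/

namespace Ipomset

variable {A γ : Type*}

/-- Let `P` be the restriction of `R` to `I` with source interface `S`, and with target interface
listed by `e`.  To a set `B` of target events, the quotient data of `P` assigns the prefix quotient
of `L` by `P - B`, as the only element of a set of quotients; this set is empty if `P - B` is not
defined because `B` contains source events. -/
def quotientData (L : Set (Ipomset A)) (R : Iposet A γ) (I S : Set γ) {U : List A}
    (e : Fin U.length → γ) (B : Set (Fin U.length)) : Set (Set (Ipomset A)) :=
  {M | ∃ p, R.Part (I \ e '' B) S (Set.range e \ e '' B) p ∧ M = prefixQuotient p L}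

/-- The prefix quotient of `M` by the terminator from `U - B` to `V - B`, where `V` is a sub-loset
of `U` and `B` is a set of positions of `V`. -/
def terminatorQuotient {U V : List A} (f : SubLoset V U) (B : Set (Fin V.length))
    (M : Set (Ipomset A)) : Set (Ipomset A) :=
  {q | ∃ s t, (discrete U ∅ ∅).Part (f.incl '' B)ᶜ (f.incl '' B)ᶜ (f.kept \ f.incl '' B) s ∧
    Glues s q t ∧ t ∈ M}

/-- The effect of removing events from an iposet on its quotient data. -/
def lowerFace {U V : List A} (f : SubLoset V U)
    (F : Set (Fin U.length) → Set (Set (Ipomset A))) (B : Set (Fin V.length)) :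
    Set (Set (Ipomset A)) :=
  F (f.incl '' B ∪ f.keptᶜ)

/-- The effect of removing events from the target interface of an iposet on its quotient data. -/
def upperFace {U V : List A} (f : SubLoset V U)
    (F : Set (Fin U.length) → Set (Set (Ipomset A))) (B : Set (Fin V.length)) :
    Set (Set (Ipomset A)) :=
  terminatorQuotient f B '' F (f.incl '' B)

theorem image_kept_compl {U V : List A} {e : Fin U.length → γ} (he : Function.Injective e)
    (f : SubLoset V U) : e '' f.keptᶜ = Set.range e \ Set.range (e ∘ f.incl) := by
  rw [Set.image_compl_eq_range_sdiff_image he, range_comp_incl]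

theorem lowerFace_quotientData (L : Set (Ipomset A)) (R : Iposet A γ) (I S : Set γ)
    {U V : List A} {e : Fin U.length → γ} (he : Function.Injective e) (f : SubLoset V U) :
    lowerFace f (quotientData L R I S e) =
      quotientData L R (I \ e '' f.keptᶜ) S (e ∘ f.incl) := by
  funext B
  have h1 : I \ e '' (f.incl '' B ∪ f.keptᶜ) = (I \ e '' f.keptᶜ) \ (e ∘ f.incl) '' B := by
    rw [Set.image_union, Set.union_comm, ← Set.sdiff_sdiff, Set.image_comp]
  have h2 : Set.range e \ e '' (f.incl '' B ∪ f.keptᶜ) =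
      Set.range (e ∘ f.incl) \ (e ∘ f.incl) '' B := by
    rw [Set.image_union, Set.union_comm, ← Set.sdiff_sdiff, ← Set.image_comp,
      Set.image_compl_eq_range_sdiff_image he,
      Set.sdiff_sdiff_cancel_left (Set.image_subset_range _ _), range_comp_incl]
  simp only [lowerFace, quotientData, h1, h2]

theorem Glues.terminatorQuotient_eq {L : Set (Ipomset A)} {p s x : Ipomset A} (h : Glues p s x) :
    {q | ∃ t, Glues s q t ∧ t ∈ prefixQuotient p L} = prefixQuotient x L := by
  ext q
  constructor
  · rintro ⟨t, ht, r, hr, hpt⟩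
    obtain ⟨x', hx', hq⟩ := ht.assoc_left hpt
    exact ⟨r, hr, h.unique hx' ▸ hq⟩
  · rintro ⟨r, hr, hq⟩
    obtain ⟨t, ht, hpt⟩ := h.assoc_right hq
    exact ⟨t, ht, r, hr, hpt⟩

theorem terminatorQuotient_prefixQuotient [Finite γ] {L : Set (Ipomset A)} {R : Iposet A γ}
    {I S : Set γ} {U V : List A} {e : Fin U.length → γ} (he : R.IsListing U e)
    (heI : Set.range e ⊆ I) {f : SubLoset V U} {B : Set (Fin V.length)} {p x : Ipomset A}
    (hp : R.Part (I \ e '' (f.incl '' B)) S (Set.range e \ e '' (f.incl '' B)) p)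
    (hx : R.Part (I \ e '' (f.incl '' B)) S
      (Set.range (e ∘ f.incl) \ e '' (f.incl '' B)) x) :
    terminatorQuotient f B (prefixQuotient p L) = prefixQuotient x L := by
  obtain ⟨s, hs⟩ := (discrete U ∅ ∅).exists_part (I := (f.incl '' B)ᶜ) (S := (f.incl '' B)ᶜ)
    (T := f.kept \ f.incl '' B) (Set.toFinite _) subset_rfl (fun x hx => hx.2)
    (fun _ _ _ _ => id) (fun _ _ _ _ => id)
  have hs' := (he.isEmb ∅ ∅).part_image hs
  rw [Set.image_compl_eq_range_sdiff_image he.injective, Set.image_sdiff he.injective] at hs'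
  have hint : (I \ e '' (f.incl '' B)) ∩ (Set.range e \ e '' (f.incl '' B)) =
      Set.range e \ e '' (f.incl '' B) :=
    Set.inter_eq_right.2 (Set.sdiff_subset_sdiff_left heI)
  have hg : Glues p s x := by
    refine (glues_iff hx).2 ⟨I \ e '' (f.incl '' B), Set.range e \ e '' (f.incl '' B),
      ⟨Set.union_eq_left.2 (Set.sdiff_subset_sdiff_left heI), hp.source_subset,
        Set.sdiff_subset_sdiff_left (Set.range_comp_subset_range _ _),
        fun _ _ _ b hb hb' => absurd ⟨heI hb.1, hb.2⟩ hb'⟩, ?_, ?_⟩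
    · rwa [hint]
    · rw [hint, range_comp_incl]
      exact hs'
  rw [← hg.terminatorQuotient_eq]
  ext q
  constructor
  · rintro ⟨s', t, hs'', h⟩
    exact ⟨t, hs''.unique hs ▸ h⟩
  · rintro ⟨t, h⟩
    exact ⟨s, t, hs, h⟩

theorem upperFace_quotientData [Finite γ] (L : Set (Ipomset A)) {R : Iposet A γ} {I : Set γ}
    (S : Set γ) {U V : List A} {e : Fin U.length → γ} (he : R.IsListing U e)
    (heI : Set.range e ⊆ I) (hmax : ∀ x ∈ Set.range e, ∀ y ∈ I, ¬ R.prec x y)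
    (f : SubLoset V U) :
    upperFace f (quotientData L R I S e) = quotientData L R I S (e ∘ f.incl) := by
  funext B
  ext M
  have hsub : Set.range (e ∘ f.incl) ⊆ Set.range e := Set.range_comp_subset_range _ _
  constructor
  · rintro ⟨_, ⟨p, hp, rfl⟩, rfl⟩
    obtain ⟨x, hx⟩ := R.exists_part (I := I \ e '' (f.incl '' B)) (S := S)
      (T := Set.range (e ∘ f.incl) \ e '' (f.incl '' B)) (Set.toFinite _) hp.source_subset
      (Set.sdiff_subset_sdiff_left (hsub.trans heI))
      (fun a ha b hb => hp.not_prec_source ha hb) (fun a ha b hb => hmax a (hsub ha.1) b hb.1)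
    rw [terminatorQuotient_prefixQuotient he heI hp hx]
    refine ⟨x, ?_, rfl⟩
    rwa [Set.image_comp]
  · rintro ⟨x, hx, rfl⟩
    rw [Set.image_comp] at hx
    obtain ⟨p, hp⟩ := R.exists_part (I := I \ e '' (f.incl '' B)) (S := S)
      (T := Set.range e \ e '' (f.incl '' B)) (Set.toFinite _) hx.source_subset
      (Set.sdiff_subset_sdiff_left heI)
      (fun a ha b hb => hx.not_prec_source ha hb) (fun a ha b hb => hmax a ha.1 b hb.1)
    exact ⟨_, ⟨p, hp, rfl⟩, terminatorQuotient_prefixQuotient he heI hp hx⟩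

/-- `F` is the quotient data of some finite iposet. -/
def IsQuotientData (L : Set (Ipomset A)) (U : List A)
    (F : Set (Fin U.length) → Set (Set (Ipomset A))) : Prop :=
  ∃ (n : ℕ) (R : Iposet A (Fin n)) (I S : Set (Fin n)) (e : Fin U.length → Fin n),
    R.IsListing U e ∧ Set.range e ⊆ I ∧ (∀ x ∈ Set.range e, ∀ y ∈ I, ¬ R.prec x y) ∧
      F = quotientData L R I S e

theorem IsQuotientData.lowerFace {L : Set (Ipomset A)} {U V : List A}
    {F : Set (Fin U.length) → Set (Set (Ipomset A))} (h : IsQuotientData L U F)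
    (f : SubLoset V U) : IsQuotientData L V (lowerFace f F) := by
  obtain ⟨n, R, I, S, e, he, heI, hmax, rfl⟩ := h
  refine ⟨n, R, I \ e '' f.keptᶜ, S, e ∘ f.incl, he.comp_subLoset f, ?_, ?_,
    lowerFace_quotientData L R I S he.injective f⟩
  · rw [image_kept_compl he.injective]
    exact fun x hx => ⟨heI (Set.range_comp_subset_range _ _ hx), fun h => h.2 hx⟩
  · exact fun x hx y hy => hmax x (Set.range_comp_subset_range _ _ hx) y hy.1

theorem IsQuotientData.upperFace {L : Set (Ipomset A)} {U V : List A}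
    {F : Set (Fin U.length) → Set (Set (Ipomset A))} (h : IsQuotientData L U F)
    (f : SubLoset V U) : IsQuotientData L V (upperFace f F) := by
  obtain ⟨n, R, I, S, e, he, heI, hmax, rfl⟩ := h
  have hsub : Set.range (e ∘ f.incl) ⊆ Set.range e := Set.range_comp_subset_range _ _
  exact ⟨n, R, I, S, e ∘ f.incl, he.comp_subLoset f, hsub.trans heI,
    fun x hx => hmax x (hsub hx), upperFace_quotientData L S he heI hmax f⟩

end Ipomset

theorem SubLoset.length_le {A : Type*} {U V : List A} (f : SubLoset V U) :
    V.length ≤ U.length := by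
  simpa using Fintype.card_le_of_injective _ f.incl.injective

theorem SubLoset.kept_trans {A : Type*} {U V W : List A} (g : SubLoset W V) (f : SubLoset V U) :
    (g.trans f).kept = f.incl '' g.kept := by
  rw [SubLoset.kept, SubLoset.kept, ← Set.range_comp]; rfl

theorem SubLoset.image_kept_compl {A : Type*} {U V V' W : List A} {f : SubLoset V U}
    {g : SubLoset W V} {f' : SubLoset V' U} (h : f.kept ∪ f'.kept = Set.univ)
    (hg : (g.trans f).kept = f.kept ∩ f'.kept) : f.incl '' g.keptᶜ = f'.keptᶜ := by
  rw [Set.image_compl_eq_range_sdiff_image f.incl.injective, ← SubLoset.kept_trans, hg]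
  change f.kept \ _ = _
  rw [Set.sdiff_self_inter]
  ext x
  have : x ∈ f.kept ∪ f'.kept := h ▸ Set.mem_univ x
  exact ⟨fun h => h.2, fun h => ⟨this.resolve_right h, h⟩⟩

theorem lowerFace_upperFace_comm {A : Type*} {L : Set (Ipomset A)} {U V V' W : List A}
    {f : SubLoset V U} {g : SubLoset W V} {f' : SubLoset V' U} {g' : SubLoset W V'}
    {F : Set (Fin U.length) → Set (Set (Ipomset A))} (hF : IsQuotientData L U F)
    (h : f.kept ∪ f'.kept = Set.univ) (hg : (g.trans f).kept = f.kept ∩ f'.kept)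
    (hg' : (g'.trans f').kept = f.kept ∩ f'.kept) :
    lowerFace g (upperFace f F) = upperFace g' (lowerFace f' F) := by
  obtain ⟨n, R, I, S, e, he, heI, hmax, rfl⟩ := hF
  have hsub : Set.range (e ∘ f'.incl) ⊆ Set.range e := Set.range_comp_subset_range _ _
  have hgg : g.trans f = g'.trans f' := SubLoset.ext_of_kept (hg.trans hg'.symm)
  rw [upperFace_quotientData L S he heI hmax, lowerFace_quotientData L R I S he.injective,
    lowerFace_quotientData L R I S (he.comp_subLoset f).injective,
    upperFace_quotientData L S (he.comp_subLoset f')]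
  · have h1 : (e ∘ f.incl) ∘ g.incl = (e ∘ f'.incl) ∘ g'.incl := by
      change e ∘ (g.trans f).incl = e ∘ (g'.trans f').incl
      rw [hgg]
    rw [h1, Set.image_comp e f.incl, SubLoset.image_kept_compl h hg]
  · rw [Ipomset.image_kept_compl he.injective]
    exact fun x hx => ⟨heI (hsub hx), fun h => h.2 hx⟩
  · exact fun x hx y hy => hmax x (hsub hx) y hy.1

/-! ### The automaton of a language -/

theorem lowerFace_trans {A : Type*} {U V W : List A} (g : SubLoset W V) (f : SubLoset V U)
    (F : Set (Fin U.length) → Set (Set (Ipomset A))) :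
    lowerFace g (lowerFace f F) = lowerFace (g.trans f) F := by
  funext B
  have : f.incl '' (g.incl '' B ∪ g.keptᶜ) ∪ f.keptᶜ =
      (g.trans f).incl '' B ∪ (g.trans f).keptᶜ := by
    rw [Set.image_union, Set.union_assoc, ← Set.image_comp, SubLoset.kept_trans,
      Set.image_compl_eq_range_sdiff_image f.incl.injective]
    congr 1
    ext x
    constructor
    · rintro (h | h)
      · exact h.2
      · exact fun h' => h (Set.image_subset_range _ _ h')
    · intro h
      by_cases hx : x ∈ f.kept
      · exact Or.inl ⟨hx, h⟩
      · exact Or.inr hx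
  exact congrArg F this

theorem upperFace_trans {A : Type*} {L : Set (Ipomset A)} {U V W : List A} (g : SubLoset W V)
    (f : SubLoset V U) {F : Set (Fin U.length) → Set (Set (Ipomset A))}
    (hF : IsQuotientData L U F) : upperFace g (upperFace f F) = upperFace (g.trans f) F := by
  obtain ⟨n, R, I, S, e, he, heI, hmax, rfl⟩ := hF
  have hsub : Set.range (e ∘ f.incl) ⊆ Set.range e := Set.range_comp_subset_range _ _
  rw [upperFace_quotientData L S he heI hmax, upperFace_quotientData L S he heI hmax,
    upperFace_quotientData L S (he.comp_subLoset f) (hsub.trans heI) fun x hx => hmax x (hsub hx)]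
  rfl

theorem lowerFace_refl {A : Type*} {U : List A}
    (F : Set (Fin U.length) → Set (Set (Ipomset A))) : lowerFace (SubLoset.refl U) F = F := by
  funext B
  have : (SubLoset.refl U).incl '' B ∪ (SubLoset.refl U).keptᶜ = B := by
    rw [kept_refl, Set.compl_univ, Set.union_empty]
    exact Set.image_id B
  exact congrArg F this

theorem upperFace_refl {A : Type*} {L : Set (Ipomset A)} {U : List A}
    {F : Set (Fin U.length) → Set (Set (Ipomset A))} (hF : IsQuotientData L U F) :
    upperFace (SubLoset.refl U) F = F := by
  obtain ⟨n, R, I, S, e, he, heI, hmax, rfl⟩ := hF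
  rw [upperFace_quotientData L S he heI hmax]
  rfl

/-- The Myhill–Nerode automaton of `L`, truncated to dimension `N`.  Its cells over `U` are the
quotient data of iposets with target interface `U`.  Cells for which the quotient at `∅` is
undefined are dead: they are not reachable from start cells. -/
def nerodeHDA {A : Type u} (L : Set (Ipomset A)) (N : ℕ) : HDA.{u, u} A where
  cell U := {F : Set (Fin U.length) → Set (Set (Ipomset A)) //
    U.length ≤ N ∧ IsQuotientData L U F}
  face ν _ _ f x := match ν with
    | 0 => ⟨lowerFace f x.1, f.length_le.trans x.2.1, x.2.2.lowerFace f⟩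
    | 1 => ⟨upperFace f x.1, f.length_le.trans x.2.1, x.2.2.upperFace f⟩
  face_refl ν U x := match ν with
    | 0 => Subtype.ext (lowerFace_refl x.1)
    | 1 => Subtype.ext (upperFace_refl x.2.2)
  face_trans ν U V W f g x := match ν with
    | 0 => Subtype.ext (lowerFace_trans g f x.1)
    | 1 => Subtype.ext (upperFace_trans g f x.2.2)
  face_comm ν μ U V V' W f g f' g' x h hg hg' := by
    have hgg : g.trans f = g'.trans f' := SubLoset.ext_of_kept (hg.trans hg'.symm)
    match ν, μ with
    | 0, 0 => exact Subtype.ext ((lowerFace_trans g f x.1).trans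
        ((congrArg (lowerFace · x.1) hgg).trans (lowerFace_trans g' f' x.1).symm))
    | 1, 1 => exact Subtype.ext ((upperFace_trans g f x.2.2).trans
        ((congrArg (upperFace · x.1) hgg).trans (upperFace_trans g' f' x.2.2).symm))
    | 0, 1 => exact Subtype.ext (lowerFace_upperFace_comm x.2.2 h hg hg')
    | 1, 0 => exact Subtype.ext (lowerFace_upperFace_comm x.2.2 (Set.union_comm _ _ ▸ h)
        (Set.inter_comm _ _ ▸ hg') (Set.inter_comm _ _ ▸ hg)).symm
  start := {x | ∃ M ∈ x.2.1 ∅, M ⊆ L}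
  accept := {x | ∀ M ∈ x.2.1 ∅, idn x.1 ∈ M}

theorem finite_nerodeHDA_cell {A : Type u} [Finite A] {L : Set (Ipomset A)} (N : ℕ)
    (hL : (prefixQuotients L).Finite) : Finite (nerodeHDA L N).Cell := by
  have : Finite {U : List A // U.length ≤ N} := (List.finite_length_le A N).to_subtype
  have : Finite (prefixQuotients L) := hL.to_subtype
  let φ : (nerodeHDA L N).Cell →
      (U : {U : List A // U.length ≤ N}) × (Set (Fin U.1.length) → Set (prefixQuotients L)) :=
    fun x => ⟨⟨x.1, x.2.2.1⟩, fun B => Subtype.val ⁻¹' x.2.1 B⟩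
  refine Finite.of_injective φ ?_
  rintro ⟨U, F, hU, hF⟩ ⟨U', F', hU', hF'⟩ h
  obtain rfl : U = U' := congrArg Subtype.val (Sigma.mk.inj h).1
  have h2 := congrFun (eq_of_heq (Sigma.mk.inj h).2)
  have hsub : ∀ {F : Set (Fin U.length) → Set (Set (Ipomset A))}, IsQuotientData L U F →
      ∀ B, F B ⊆ Set.range (Subtype.val : prefixQuotients L → _) := by
    rintro _ ⟨n, R, I, S, e, -, -, -, rfl⟩ B _ ⟨p, -, rfl⟩
    exact ⟨⟨_, p, rfl⟩, rfl⟩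
  have hFF : F = F' := by
    funext B
    rw [← Set.image_preimage_eq_of_subset (hsub hF B),
      ← Set.image_preimage_eq_of_subset (hsub hF' B)]
    exact congrArg (Subtype.val '' ·) (h2 B)
  subst hFF
  rfl

namespace Iposet

variable {A γ : Type*}

theorem Part.congr {R R' : Iposet A γ} {I S T : Set γ} {p : Ipomset A} (h : R.Part I S T p)
    (hprec : ∀ x ∈ I, ∀ y ∈ I, R.prec x y ↔ R'.prec x y)
    (hevord : ∀ x y, R.evord x y ↔ R'.evord x y) (hlabel : ∀ x, R.label x = R'.label x) :
    R'.Part I S T p := by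
  obtain ⟨n, P, e, rfl, h⟩ := h
  have hI : ∀ x, e x ∈ I := fun x => h.range ▸ Set.mem_range_self x
  exact ⟨n, P, e, rfl, h.inj, h.range, h.source, h.target, fun x => by rw [← hlabel, h.label],
    fun x y => by rw [h.prec, hprec _ (hI x) _ (hI y)],
    fun x y hc => by rw [h.evord x y hc, hevord]⟩

end Iposet

namespace Ipomset

variable {A γ : Type*}

/-! ### Delaying events -/

/-- If target events which are not source events are removed from `p`, and started again later by
a starter, the result is subsumed by `p`: these events are now preceded by all those that have
terminated in `p`.  This holds after gluing with any `q` on the right. -/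
theorem exists_glues_subsumed {R₀ : Iposet A γ} {I S : Set γ} {U V : List A}
    {e : Fin U.length → γ} (he : R₀.IsListing U e) {f : SubLoset V U} {p p' q t r : Ipomset A}
    (hp : R₀.Part I S (Set.range e) p)
    (hp' : R₀.Part (I \ e '' f.keptᶜ) S (Set.range e \ e '' f.keptᶜ) p')
    (h : Glues p q r) (ht : Glues (starter f) q t) : ∃ r', Glues p' t r' ∧ Subsumed r' r := by
  obtain ⟨n, R, rfl⟩ := r.exists_rep
  obtain ⟨I₁, K, hc, hp₁, hq⟩ := (glues_iff (part_univ R)).1 h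
  obtain ⟨e₁, he₁, her₁, ht₁⟩ := ht.part_of_starter hq
  obtain ⟨B, hB⟩ : ∃ B, e₁ '' f.keptᶜ = B := ⟨_, rfl⟩
  -- The part `p'` of `p`, seen inside `R`.
  have hp₁' : R.Part (I₁ \ B) R.source ((I₁ ∩ K) \ B) p' := by
    obtain ⟨m, P, rfl⟩ := p.exists_rep
    obtain ⟨φ₀, hφ₀⟩ := hp.exists_isEmb
    obtain ⟨φ₁, hφ₁⟩ := hp₁.exists_isEmb
    obtain ⟨l, rfl⟩ := hφ₀.exists_lift_range hp.target_subset
    have hl := hφ₀.isListing_comp.1 he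
    have hlr : Set.range l = P.target := by
      have := hφ₀.target
      rw [Set.range_comp] at this
      exact ((Set.image_injective.2 hφ₀.inj) this).symm
    obtain rfl : φ₁ ∘ l = e₁ := eq_of_heq (Sigma.mk.inj
      ((hφ₁.isListing_comp.2 hl).unique he₁ (by rw [Set.range_comp, hlr, hφ₁.target, her₁]))).2
    have := hφ₁.part_image (hφ₀.part_preimage Set.sdiff_subset hp')
    rw [Set.preimage_sdiff, Set.preimage_sdiff, ← hφ₀.range, Set.preimage_range, Set.image_comp φ₀,
      hφ₀.inj.preimage_image, Set.image_sdiff hφ₁.inj, Set.image_univ, hφ₁.range, ← hφ₀.source,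
      hφ₀.inj.preimage_image, hφ₁.source, ← Set.image_comp, hB, Set.range_comp φ₀,
      hφ₀.inj.preimage_image, Set.image_sdiff hφ₁.inj, hlr, hφ₁.target, ← Set.image_comp, hB]
      at this
    exact this
  have hBIK : B ⊆ I₁ ∩ K := by
    rw [← hB, ← her₁]; exact Set.image_subset_range _ _
  obtain ⟨b, d, hbd, hR⟩ := R.interval
  have hcov : ∀ u, u ∈ I₁ \ B ∨ u ∈ K := fun u => by
    have : u ∈ I₁ ∪ K := hc.union ▸ Set.mem_univ u
    by_cases hu : u ∈ B
    · exact Or.inr (hBIK hu).2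
    · exact this.imp (fun h => ⟨h, hu⟩) id
  obtain ⟨b', d', hbd', h1, h2, h3, h4⟩ := exists_interval_of_cut (I₁ \ B) K hcov b d b d
    (fun u _ => hbd u) (fun u _ => hbd u)
  have hI : ∀ u ∈ I₁ \ B, ∀ v ∈ I₁ \ B, R.prec u v ↔ d' u < b' v := by
    intro u hu v hv
    by_cases huK : u ∈ K
    · exact iff_of_false (hp₁.not_target_prec ⟨hu.1, huK⟩ hv.1) (h4 u huK v hv)
    · rw [h1 u hu huK v hv, hR]
  have hK : ∀ u ∈ K, ∀ v ∈ K, R.prec u v ↔ d' u < b' v := by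
    intro u hu v hv
    by_cases hvI : v ∈ I₁ \ B
    · exact iff_of_false (hq.not_prec_source ⟨hvI.1, hv⟩ hu) (h4 u hu v hvI)
    · rw [h2 u hu v hv hvI, hR]
  have hle : ∀ u v, R.prec u v → d' u < b' v := by
    intro u v huv
    by_cases h1 : u ∈ I₁ \ B ∧ v ∈ I₁ \ B
    · exact (hI u h1.1 v h1.2).1 huv
    by_cases h2 : u ∈ K ∧ v ∈ K
    · exact (hK u h2.1 v h2.2).1 huv
    rcases hcov u with hu | hu <;> rcases hcov v with hv | hv
    · exact absurd ⟨hu, hv⟩ h1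
    · exact h3 u hu (fun h => h2 ⟨h, hv⟩) v hv fun h => h1 ⟨hu, h⟩
    · have hvK : v ∉ K := fun h => h2 ⟨hu, h⟩
      by_cases huI : u ∈ I₁
      · exact absurd huv (hp₁.not_target_prec ⟨huI, hu⟩ hv.1)
      · exact absurd huv (R.prec_asymm (hc.prec v hv.1 hvK u hu huI))
    · exact absurd ⟨hu, hv⟩ h2
  let R' : Iposet A (Fin n) :=
    { R with
      prec := fun u v => d' u < b' v
      prec_irrefl := fun u => not_lt.2 (hbd' u)
      prec_trans := fun _ y _ hxy hyz => hxy.trans_le ((hbd' y).trans hyz.le)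
      related := fun u v huv => (R.related u v huv).imp (hle u v) (Or.imp_left (hle v u))
      interval := ⟨b', d', hbd', fun _ _ => Iff.rfl⟩
      source_minimal := fun u hu v hvu => by
        have huI := hp₁'.source_subset hu
        by_cases hv : v ∈ K
        · exact h4 v hv u huI hvu
        · have hvI := (hcov v).resolve_right hv
          exact R.source_minimal u hu v ((hI v hvI u huI).2 hvu)
      target_maximal := fun u hu v huv => by
        have huK := hc.target hu
        by_cases hv : v ∈ I₁ \ B
        · exact h4 u huK v hv huv
        · exact R.target_maximal u hu v ((hK u huK v ((hcov v).resolve_left hv)).2 huv) }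
  have hint : (I₁ \ B) ∩ K = (I₁ ∩ K) \ B := by
    ext u; exact ⟨fun h => ⟨⟨h.1.1, h.2⟩, h.1.2⟩, fun h => ⟨⟨h.1.1, h.2⟩, h.1.2⟩⟩
  have hkept : e₁ '' f.kept = (I₁ ∩ K) \ B := by
    rw [← hB, ← her₁, Set.image_compl_eq_range_sdiff_image he₁.injective,
      Set.sdiff_sdiff_cancel_left (Set.image_subset_range _ _)]
  refine ⟨mk R', (glues_iff (part_univ R')).2 ⟨I₁ \ B, K, ⟨?_, hp₁'.source_subset, hc.target, h3⟩,
    ?_, ?_⟩, n, n, R', R, rfl, rfl, Equiv.refl _, Set.image_id _, Set.image_id _, fun _ => rfl, hle,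
    fun _ _ _ h => h⟩
  · exact Set.eq_univ_of_forall hcov
  · rw [hint]
    exact hp₁'.congr hI (fun _ _ => Iff.rfl) fun _ => rfl
  · rw [hint]
    exact (hkept ▸ ht₁).congr hK (fun _ _ => Iff.rfl) fun _ => rfl

/-! ### Soundness of the automaton -/

theorem mem_of_path_nerodeHDA {A : Type u} {L : Set (Ipomset A)} (hL : IsLanguage L) {N : ℕ}
    {x y : (nerodeHDA L N).Cell} (α : (nerodeHDA L N).Path x y) {p q r : Ipomset A}
    (hα : α.HasEvent p) (h : Glues p q r) (hq : ∀ M ∈ y.2.1 ∅, q ∈ M) :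
    ∀ M ∈ x.2.1 ∅, r ∈ M := by
  induction α generalizing p r with
  | nil x =>
    obtain rfl := hα
    exact h.eq_of_idn_left ▸ hq
  | cons s α ih =>
    obtain ⟨p', hp', hs⟩ := hα
    obtain ⟨u, hu, hsu⟩ := hs.assoc_right h
    have hu' := ih hp' hu hq
    cases s with
    | @up U V f x =>
      obtain ⟨F, hN, n, R, I, S, e, he, heI, hmax, rfl⟩ := x
      rintro M hM
      change M ∈ lowerFace f (quotientData L R I S e) ∅ at hM
      rw [lowerFace, Set.image_empty, Set.empty_union] at hM
      obtain ⟨p₁', hp₁', rfl⟩ := hM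
      -- A target event is never preceded by others, so sources of `P - B` are sources of `P`.
      obtain ⟨p₁, hp₁⟩ := R.exists_part (I := I) (S := S) (T := Set.range e) (Set.toFinite _)
        (hp₁'.source_subset.trans Set.sdiff_subset) heI (fun a ha b hb hba => by
          by_cases hbB : b ∈ e '' f.keptᶜ
          · exact hmax b (Set.image_subset_range _ _ hbB) a (hp₁'.source_subset ha).1 hba
          · exact hp₁'.not_prec_source ha ⟨hb, hbB⟩ hba) hmax
      obtain ⟨r₁, hr₁, hg⟩ : u ∈ prefixQuotient p₁ L := hu' _ ⟨p₁, by
        rwa [Set.image_empty, Set.sdiff_empty, Set.sdiff_empty], rfl⟩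
      obtain ⟨r', hr', hsub⟩ := exists_glues_subsumed he hp₁ hp₁' hg hsu
      exact ⟨r', hL _ _ hsub hr₁, hr'⟩
    | @down U V f x =>
      intro M hM
      obtain ⟨s, t, hs', ht, htM⟩ : u ∈ terminatorQuotient f ∅ M :=
        hu' _ ⟨M, by rwa [Set.image_empty], rfl⟩
      rw [Set.image_empty, Set.compl_empty, Set.sdiff_empty] at hs'
      obtain rfl : s = terminator f := hs'.unique (part_discrete_iff.2
        ⟨id, discrete_isListing U ∅ ∅, Set.range_id, Set.image_id _, Set.image_id _⟩)
      exact ht.unique hsu ▸ htM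

theorem language_nerodeHDA_subset {A : Type u} {L : Set (Ipomset A)} (hL : IsLanguage L) (N : ℕ) :
    (nerodeHDA L N).language ⊆ L := by
  rintro p ⟨x, ⟨M, hM, hML⟩, y, hy, α, hα⟩
  obtain ⟨n, P, rfl⟩ := p.exists_rep
  obtain ⟨e, he, her⟩ := (α.exists_isListing (part_univ P) hα).2
  have hid := glues_idn_right he (her.symm ▸ part_univ P)
  exact hML (mem_of_path_nerodeHDA hL α hα hid hy M hM)

/-! ### Bounding the dimension -/

/-- The number of source events. -/
noncomputable def sourceCard (p : Ipomset A) : ℕ := (Quotient.out p).2.source.ncard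

theorem _root_.Iposet.Part.sourceCard_eq {R : Iposet A γ} {I S T : Set γ} {p : Ipomset A}
    (h : R.Part I S T p) : p.sourceCard = S.ncard := by
  have hp : p = mk (Quotient.out p).2 := (Quotient.out_eq p).symm
  rw [hp] at h
  obtain ⟨e, he⟩ := h.exists_isEmb
  rw [sourceCard, ← he.source, Set.ncard_image_of_injective _ he.inj]

/-- All elements of a prefix quotient by `p` have as many source events as `p` has target events,
so finitely many quotients leave only finitely many possible numbers. -/
theorem exists_sourceCard_le {L : Set (Ipomset A)} (hL : (prefixQuotients L).Finite) :
    ∃ N, ∀ p q r, r ∈ L → Glues p q r → q.sourceCard ≤ N := by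
  have h1 : ∀ M ∈ prefixQuotients L, ∃ N, ∀ q ∈ M, q.sourceCard ≤ N := by
    rintro _ ⟨p, rfl⟩
    obtain ⟨n, P, rfl⟩ := p.exists_rep
    refine ⟨P.target.ncard, ?_⟩
    rintro q ⟨r, -, hr⟩
    obtain ⟨m, R, rfl⟩ := r.exists_rep
    obtain ⟨I, K, hc, hp, hq⟩ := (glues_iff (part_univ R)).1 hr
    obtain ⟨φ, hφ⟩ := hp.exists_isEmb
    rw [hq.sourceCard_eq, ← hφ.target, Set.ncard_image_of_injective _ hφ.inj]
  choose! N hN using h1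
  obtain ⟨C, hC⟩ := (hL.image N).bddAbove
  exact ⟨C, fun p q r hr h =>
    (hN _ ⟨p, rfl⟩ q ⟨r, hr, h⟩).trans (hC ⟨_, ⟨p, rfl⟩, rfl⟩)⟩

/-! ### Completeness of the automaton -/

/-- If every unstarted event has a predecessor among the remaining events `K`, then some active
event precedes all unstarted ones: one whose interval ends first. -/
theorem _root_.Iposet.exists_prec_all {n : ℕ} (R : Iposet A (Fin n)) {I K : Set (Fin n)}
    (hne : (K \ I).Nonempty) (h : ∀ y ∈ K \ I, ∃ x ∈ K, R.prec x y) :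
    ∃ x ∈ I ∩ K, ∀ y ∈ K \ I, R.prec x y := by
  obtain ⟨b, d, hbd, hR⟩ := R.interval
  obtain ⟨y, hy, hymin⟩ := Set.exists_min_image (K \ I) b (Set.toFinite _) hne
  obtain ⟨x₀, hx₀, hxy₀⟩ := h y hy
  obtain ⟨x, hx, hxmin⟩ := Set.exists_min_image K d (Set.toFinite _) ⟨x₀, hx₀⟩
  have hxy : d x < b y := (hxmin x₀ hx₀).trans_lt ((hR _ _).1 hxy₀)
  refine ⟨x, ⟨by_contra fun hxI => ?_, hx⟩, fun y' hy' => (hR _ _).2 (hxy.trans_le (hymin y' hy'))⟩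
  exact absurd hxy (not_lt.2 ((hymin x ⟨hx, hxI⟩).trans (hbd x)))

/-- From the cell of a prefix of `R ∈ L`, an accept cell is reached by a path whose event ipomset
is the remaining suffix. -/
theorem exists_path_nerodeHDA {A : Type u} {L : Set (Ipomset A)} {N n : ℕ}
    (hN : ∀ p q r, r ∈ L → Glues p q r → q.sourceCard ≤ N) {R : Iposet A (Fin n)}
    (hR : mk R ∈ L) (m : ℕ) {I K : Set (Fin n)} (hm : Iᶜ.ncard + K.ncard = m)
    (hc : R.IsCut Set.univ R.source R.target I K) {U : List A} {e : Fin U.length → Fin n}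
    (he : R.IsListing U e) (her : Set.range e = I ∩ K)
    (hmax : ∀ x ∈ I ∩ K, ∀ y ∈ I, ¬ R.prec x y) {q : Ipomset A}
    (hq : R.Part K (I ∩ K) R.target q) (x : (nerodeHDA L N).cell U)
    (hx : x.1 = quotientData L R I R.source e) :
    ∃ y ∈ (nerodeHDA L N).accept, ∃ α : (nerodeHDA L N).Path ⟨U, x⟩ y, α.HasEvent q := by
  induction m using Nat.strong_induction_on generalizing I K U q with
  | _ m ih =>
  subst hm
  by_cases h : ∃ a ∈ K \ I, ∀ y ∈ K, ¬ R.prec y a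
  · -- A minimal unstarted event is started.
    obtain ⟨a, ha, hamin⟩ := h
    have hmin : ∀ x ∈ insert a (I ∩ K), ∀ y ∈ K, ¬ R.prec y x := by
      rintro x (rfl | hx) y hy
      · exact hamin y hy
      · exact hq.not_prec_source hx hy
    have hSK : insert a (I ∩ K) ⊆ K := Set.insert_subset ha.1 Set.inter_subset_right
    have hint : insert a I ∩ K = insert a (I ∩ K) := Set.insert_inter_of_mem ha.1
    obtain ⟨U', e', he', her'⟩ := R.exists_isListing (Set.toFinite (insert a (I ∩ K)))
      (fun x hx y hy => hmin y hy x (hSK hx))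
    obtain ⟨f, rfl⟩ := he'.exists_subLoset he (by
      rw [her, her']; exact Set.subset_insert _ _)
    have hkept : e' '' f.keptᶜ = {a} := by
      rw [image_kept_compl he'.injective, her', her,
        Set.insert_sdiff_of_notMem _ (fun h => ha.2 h.1), Set.sdiff_self, insert_empty_eq]
    have hmax' : ∀ x ∈ insert a (I ∩ K), ∀ y ∈ insert a I, ¬ R.prec x y := by
      rintro x hx y (rfl | hy) hxy
      · exact hamin x (hSK hx) hxy
      · rcases hx with rfl | hx
        · by_cases hyK : y ∈ K
          · exact hq.not_prec_source ⟨hy, hyK⟩ ha.1 hxy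
          · exact R.prec_asymm hxy (hc.prec y hy hyK x ha.1 ha.2)
        · exact hmax x hx y hy hxy
    have hc' : R.IsCut Set.univ R.source R.target (insert a I) K :=
      ⟨by rw [Set.insert_union, hc.union, Set.insert_eq_of_mem (Set.mem_univ a)],
        hc.source.trans (Set.subset_insert _ _), hc.target,
        fun x hx hxK y hy hyI => hc.prec x (hx.resolve_left fun h => hxK (h ▸ ha.1)) hxK y hy
          fun h => hyI (Or.inr h)⟩
    obtain ⟨q', hq'⟩ := R.exists_part (I := K) (S := insert a (I ∩ K)) (T := R.target)
      (Set.toFinite _) hSK hc.target hmin (fun x hx y _ => R.target_maximal x hx y)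
    obtain ⟨p', hp'⟩ := R.exists_part (I := insert a I) (S := R.source) (T := insert a (I ∩ K))
      (Set.toFinite _) hc'.source (Set.insert_subset_insert Set.inter_subset_left)
      (fun x hx y _ => R.source_minimal x hx y) hmax'
    have hlen : U'.length ≤ N := by
      have h1 := hN p' q' _ hR ((glues_iff (part_univ R)).2
        ⟨_, _, hc', by rwa [hint], by rwa [hint]⟩)
      rw [hq'.sourceCard_eq, ← her', ← Set.image_univ,
        Set.ncard_image_of_injective _ he'.injective] at h1
      simpa using h1
    let x' : (nerodeHDA L N).cell U' := ⟨quotientData L R (insert a I) R.source e', hlen, n, R,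
      insert a I, R.source, e', he', by
        rw [her']; exact Set.insert_subset_insert Set.inter_subset_left, by rwa [her'], rfl⟩
    obtain rfl : (nerodeHDA L N).face 0 f x' = x := by
      refine Subtype.ext ?_
      rw [hx]
      change lowerFace f (quotientData L R (insert a I) R.source e') = _
      rw [lowerFace_quotientData L R _ _ he'.injective, hkept,
        Set.insert_sdiff_of_mem _ (Set.mem_singleton a), Set.sdiff_singleton_eq_self ha.2]
    obtain ⟨y, hy, α, hα⟩ := ih _ (by
      have : (insert a I)ᶜ.ncard < Iᶜ.ncard := Set.ncard_lt_ncard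
        ⟨Set.compl_subset_compl.2 (Set.subset_insert _ _), fun h => h ha.2 (Or.inl rfl)⟩
      omega) rfl hc' he' (by rw [her', hint]) (by rwa [hint]) (by rwa [hint]) x' rfl
    refine ⟨y, hy, .cons (.up f x') α, q', hα, (glues_starter_iff hq).2 ⟨e', he', ?_, ?_⟩⟩
    · rw [← range_comp_incl, her]
    · rwa [her']
  push Not at h
  by_cases h' : ∃ a ∈ I ∩ K, a ∉ R.target ∧ ∀ y ∈ K \ I, R.prec a y
  · -- An active event which precedes all unstarted events is terminated.
    obtain ⟨a, ha, haT, haprec⟩ := h'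
    have hint : I ∩ (K \ {a}) = (I ∩ K) \ {a} := (Set.inter_sdiff_assoc _ _ _).symm
    obtain ⟨V, f, hf⟩ := he.exists_restrict (I := (I ∩ K) \ {a}) (her ▸ Set.sdiff_subset)
    have hkept : e '' f.keptᶜ = {a} := by
      rw [image_kept_compl he.injective, range_comp_incl, hf, her,
        Set.sdiff_sdiff_cancel_left (Set.singleton_subset_iff.2 ha)]
    have hc' : R.IsCut Set.univ R.source R.target I (K \ {a}) := by
      refine ⟨?_, hc.source, fun x hx => ⟨hc.target hx, fun h => haT (h ▸ hx)⟩, ?_⟩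
      · refine Set.eq_univ_of_forall fun x => ?_
        by_cases hxa : x = a
        · exact Or.inl (hxa ▸ ha.1)
        · have : x ∈ I ∪ K := hc.union ▸ Set.mem_univ x
          exact this.imp id fun h => ⟨h, hxa⟩
      · intro x hx hxK y hy hyI
        by_cases hxa : x = a
        · exact hxa ▸ haprec y ⟨hy.1, hyI⟩
        · exact hc.prec x hx (fun h => hxK ⟨h, hxa⟩) y hy.1 hyI
    obtain ⟨q', hq'⟩ := R.exists_part (I := K \ {a}) (S := (I ∩ K) \ {a}) (T := R.target)
      (Set.toFinite _) (Set.sdiff_subset_sdiff_left Set.inter_subset_right) hc'.target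
      (fun x hx y hy => hq.not_prec_source hx.1 hy.1) (fun x hx y _ => R.target_maximal x hx y)
    obtain ⟨y, hy, α, hα⟩ := ih _ (by
      have : (K \ {a}).ncard < K.ncard := Set.ncard_lt_ncard
        ⟨Set.sdiff_subset, fun h => (h ha.2).2 rfl⟩
      omega) rfl hc' (he.comp_subLoset f) (by rw [range_comp_incl, hf, hint])
      (by rw [hint]; exact fun x hx => hmax x hx.1) (by rwa [hint])
      ((nerodeHDA L N).face 1 f x) (by
        change upperFace f x.1 = _
        rw [hx, upperFace_quotientData L R.source he (her ▸ Set.inter_subset_left) (by rwa [her])])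
    refine ⟨y, hy, .cons (.down f x) α, q', hα, (glues_terminator_iff hq).2 ⟨e, he, her, ?_, ?_⟩⟩
    · rwa [hkept, hf]
    · rw [hkept]
      rintro _ rfl y hy hyI
      exact haprec y ⟨hy, fun h => hyI ⟨h, hy⟩⟩
  -- No event is left: the prefix is `R` itself.
  push Not at h'
  have hKI : K \ I = ∅ := by
    by_contra hne
    obtain ⟨a, ha, haprec⟩ := R.exists_prec_all (Set.nonempty_iff_ne_empty.2 hne) h
    obtain ⟨y, hy⟩ := Set.nonempty_iff_ne_empty.2 hne
    have haT : a ∉ R.target := fun haT => R.target_maximal a haT y (haprec y hy)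
    obtain ⟨z, hz, hz'⟩ := h' a ha haT
    exact hz' (haprec z hz)
  have hKI' : K ⊆ I := Set.sdiff_eq_empty.1 hKI
  have hI : I = Set.univ := by rw [← hc.union, Set.union_eq_left.2 hKI']
  subst hI
  rw [Set.univ_inter] at her hq h'
  have hKT : K = R.target := by
    refine Set.Subset.antisymm (fun a ha => by_contra fun haT => ?_) hc.target
    obtain ⟨y, hy, -⟩ := h' a ha haT
    exact hy.2 trivial
  subst hKT
  refine ⟨⟨U, x⟩, ?_, .nil _, hq.unique (part_discrete_iff.2 ⟨e, he, her, ?_, ?_⟩)⟩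
  · intro M hM
    change M ∈ x.1 ∅ at hM
    rw [hx] at hM
    obtain ⟨p, hp, rfl⟩ := hM
    rw [Set.image_empty, Set.sdiff_empty, Set.sdiff_empty, her] at hp
    obtain rfl := hp.unique (part_univ R)
    exact ⟨mk R, hR, glues_idn_right he (her.symm ▸ hp)⟩
  · exact Set.image_univ.trans her
  · exact Set.image_univ.trans her

theorem subset_language_nerodeHDA {A : Type u} {L : Set (Ipomset A)} {N : ℕ}
    (hN : ∀ p q r, r ∈ L → Glues p q r → q.sourceCard ≤ N) : L ⊆ (nerodeHDA L N).language := by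
  intro p hp
  obtain ⟨n, R, rfl⟩ := p.exists_rep
  obtain ⟨U, e, he, her⟩ := R.exists_isListing (Set.toFinite R.source)
    (fun x _ y hy => R.source_minimal y hy x)
  have hanti : ∀ x ∈ R.source, ∀ y ∈ R.source, ¬ R.prec x y :=
    fun x _ y hy => R.source_minimal y hy x
  have hid : R.Part R.source R.source R.source (idn U) := part_discrete_iff.2
    ⟨e, he, her, by rw [Set.image_univ, her], by rw [Set.image_univ, her]⟩
  have hc : R.IsCut Set.univ R.source R.target R.source Set.univ :=
    ⟨Set.union_univ _, subset_rfl, Set.subset_univ _, fun _ _ h => absurd trivial h⟩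
  have hlen : U.length ≤ N := by
    have h1 := hN (idn U) (mk R) _ hp ((glues_iff (part_univ R)).2
      ⟨_, _, hc, by rwa [Set.inter_univ], by rw [Set.inter_univ]; exact part_univ R⟩)
    rw [(part_univ R).sourceCard_eq, ← her, ← Set.image_univ,
      Set.ncard_image_of_injective _ he.injective] at h1
    simpa using h1
  let x : (nerodeHDA L N).cell U := ⟨quotientData L R R.source R.source e, hlen, n, R, R.source,
    R.source, e, he, her.subset, by rwa [her], rfl⟩
  obtain ⟨y, hy, α, hα⟩ := exists_path_nerodeHDA hN hp _ rfl hc he (by rw [her, Set.inter_univ])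
    (by rwa [Set.inter_univ]) (by rw [Set.inter_univ]; exact part_univ R) x rfl
  refine ⟨⟨U, x⟩, ⟨prefixQuotient (idn U) L, ⟨idn U, ?_, rfl⟩, ?_⟩, y, hy, α, hα⟩
  · rwa [Set.image_empty, Set.sdiff_empty, Set.sdiff_empty, her]
  · rintro q ⟨r, hr, h⟩
    exact h.eq_of_idn_left ▸ hr

end Ipomset

theorem theorem1 {A : Type u} [Finite A] (L : Set (Ipomset A)) (hL : Ipomset.IsLanguage L) :
    List.TFAE [Ipomset.IsRegular L, (Ipomset.prefixQuotients L).Finite,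
      (Ipomset.suffixQuotients L).Finite] := by
  tfae_have 1 → 2 := by
    rintro ⟨X, hX, rfl⟩
    exact X.finite_prefixQuotients_language
  tfae_have 2 → 1 := by
    intro h
    obtain ⟨N, hN⟩ := exists_sourceCard_le h
    exact ⟨nerodeHDA L N, finite_nerodeHDA_cell N h,
      (language_nerodeHDA_subset hL N).antisymm (subset_language_nerodeHDA hN)⟩
  tfae_have 2 ↔ 3 := Ipomset.finite_prefixQuotients_iff L
  tfae_finish
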